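/- Let $H_1,H_2$ be complex Hilbert spaces, let $M_i\subset B(H_i)$ be von Neumann algebras (containing the identity), and let $\alpha_i$ be an involutive $*$-antiautomorphism of $M_i$, i.e. a complex linear map $\alpha_i:M_i\to M_i$ with $\alpha_i(x^*)=\alpha_i(x)^*$, $\alpha_i(xy)=\alpha_i(y)\alpha_i(x)$ and $\alpha_i^2=\mathrm{id}$ ($i=1,2$). Let $\Phi:M_1\to M_2$ be a normal $*$-homomorphism (not necessarily unital or surjective) with $\Phi\circ\alpha_1=\alpha_2\circ\Phi$. (I) There are a Hilbert space $L$ and a factorization $\Phi=\Phi_3\circ\Phi_2\circ\Phi_1$ such that: 1. $\Phi_1$ is the $*$-homomorphism of $M_1$ onto $M_1\overline{\otimes}\mathbb{C}1_L\subset B(H_1\otimes L)$ given by $\Phi_1(a)=a\otimes 1_L$; there is an involutive $*$-antiautomorphism $\tilde\alpha_1=\alpha_1\otimes\mathrm{id}$ of $M_1\overline{\otimes}\mathbb{C}1_L$, $\tilde\alpha_1(a\otimes 1_L)=\alpha_1(a)\otimes 1_L$, and $\Phi_1\circ\alpha_1=\tilde\alpha_1\circ\Phi_1$. 2. There is a projection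 $p'\in(M_1\overline{\otimes}\mathbb{C}1_L)'$ such that $\Phi_2$ is the $*$-homomorphism $x\mapsto xp'$ of $M_1\overline{\otimes}\mathbb{C}1_L$ onto $(M_1\overline{\otimes}\mathbb{C}1_L)p'$; the formula $\overline\alpha_1(xp')=\tilde\alpha_1(x)p'$ gives a well-defined involutive $*$-antiautomorphism $\overline\alpha_1$ of $(M_1\overline{\otimes}\mathbb{C}1_L)p'$, and $\Phi_2\circ\tilde\alpha_1=\overline\alpha_1\circ\Phi_2$. 3. $\Phi_3$ is a spatial $*$-isomorphism of $(M_1\overline{\otimes}\mathbb{C}1_L)p'$ onto $\Phi(M_1)$: there is a partial isometry $u:H_1\otimes L\to H_2$ with $u^*u=p'$, $uu^*=\Phi(1)$ and $\Phi_3(y)=uyu^*$. Moreover $\Phi_3\circ\overline\alpha_1=\alpha_2\circ\Phi_3$. In particular, if $\Phi$ is surjective, then $\Phi_3$ is a $*$-isomorphism onto $M_2$. (II) Suppose in addition that $H_i$ is the complexification $H_i^r+iH_i^r$ of a real Hilbert space $H_i^r$ on which the real algebra acts, i.e. $(M_i,\alpha_i)=\{x\in M_i:\alpha_i(x)=x^*\}$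 maps $H_i^r$ into itself, $i=1,2$; let $c_i$ be the conjugation $\xi+i\eta\mapsto\xi-i\eta$ ($\xi,\eta\in H_i^r$) of $H_i$. Then $L$ and the factorization in (I) can be chosen, together with a real Hilbert space $L^r$ with $L=L^r+iL^r$ and conjugation $c_L$, such that $\tilde\alpha_1'(p')=p'$ and $u(c_1\otimes c_L)=c_2u$. Here $\tilde\alpha_1'$ is the involutive $*$-antiautomorphism $$\tilde\alpha_1'(t)=(c_1\otimes c_L)\,t^*\,(c_1\otimes c_L)$$ of $(M_1\overline{\otimes}\mathbb{C}1_L)'$. Whenever $J_1$ is a conjugation of $H_1$ (a conjugate-linear isometric involution) that commutes with $c_1$ and satisfies $J_1M_1J_1=M_1'$, it is given on elementary tensors $x'\otimes y$, $x'\in M_1'$, $y\in B(L)$, by $$\tilde\alpha_1'(x'\otimes y)=J_1\alpha_1(J_1x'J_1)J_1\otimes c_Ly^*c_L .$$ -/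

import Mathlib

open scoped TensorProduct InnerProductSpace

universe u v

noncomputable section

namespace RealW

/-- An involutive `*`-antiautomorphism of a complex `*`-algebra `A`: a complex linear map
`α : A → A` with `α (x⋆) = (α x)⋆`, `α (x y) = α y α x` and `α (α x) = x`. -/
structure InvolutiveStarAntiAut (A : Type*) [NonUnitalRing A] [Module ℂ A] [StarRing A]
    extends A →ₗ[ℂ] A where
  map_star' : ∀ x, toFun (star x) = star (toFun x)
  map_mul_rev' : ∀ x y, toFun (x * y) = toFun y * toFun x
  involutive' : ∀ x, toFun (toFun x) = x

instance {A : Type*} [NonUnitalRing A] [Module ℂ A] [StarRing A] :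
    CoeFun (InvolutiveStarAntiAut A) (fun _ => A → A) :=
  ⟨fun α => α.toLinearMap⟩

/-- A conjugation of a complex Hilbert space `H`: a conjugate-linear isometric involution `c`.
It is the same datum as a real Hilbert space `Hʳ` with `H = Hʳ + i Hʳ`, namely
`Hʳ = {ξ | c ξ = ξ}` and `c (ξ + i η) = ξ - i η` for `ξ, η ∈ Hʳ`. -/
structure Conjugation (H : Type*) [NormedAddCommGroup H] [InnerProductSpace ℂ H]
    extends H →ₗᵢ⋆[ℂ] H where
  involutive' : ∀ ξ, toFun (toFun ξ) = ξ

section Operators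

variable {H : Type*} [NormedAddCommGroup H] [InnerProductSpace ℂ H]

instance : CoeFun (Conjugation H) (fun _ => H → H) :=
  ⟨fun c => c.toLinearIsometry⟩

/-- The complex linear operator `c x c`. -/
def Conjugation.sandwich (c : Conjugation H) (x : H →L[ℂ] H) : H →L[ℂ] H :=
  c.toLinearIsometry.toContinuousLinearMap.comp
    (x.comp c.toLinearIsometry.toContinuousLinearMap)

/-- The transpose `c x⋆ c` of `x` with respect to the real form `Hʳ = {ξ | c ξ = ξ}`. -/
def Conjugation.transpose [CompleteSpace H] (c : Conjugation H) (x : H →L[ℂ] H) : H →L[ℂ] H :=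
  c.sandwich (star x)

/-- The real algebra `(M, α) = {x ∈ M | α x = x⋆}` is contained in `B(Hʳ)`, where
`Hʳ = {ξ | c ξ = ξ}`, i.e. each of its elements maps `Hʳ` into itself. -/
def ActsOnRealForm [CompleteSpace H] (M : VonNeumannAlgebra H)
    (α : InvolutiveStarAntiAut M.toStarSubalgebra) (c : Conjugation H) : Prop :=
  ∀ x : M.toStarSubalgebra, α x = star x →
    ∀ ξ : H, c ξ = ξ → c ((x : H →L[ℂ] H) ξ) = (x : H →L[ℂ] H) ξ

/-- A `*`-homomorphism (not necessarily unital) between von Neumann algebras is normal if it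
preserves the suprema of bounded upward directed families of self-adjoint elements. -/
def IsNormal {K : Type*} [NormedAddCommGroup K] [InnerProductSpace ℂ K]
    [CompleteSpace H] [CompleteSpace K] {M : VonNeumannAlgebra H} {N : VonNeumannAlgebra K}
    (Φ : M.toStarSubalgebra →⋆ₙₐ[ℂ] N.toStarSubalgebra) : Prop :=
  ∀ D : Set M.toStarSubalgebra, D.Nonempty → (∀ x ∈ D, IsSelfAdjoint x) →
    DirectedOn (fun x y : M.toStarSubalgebra => (x : H →L[ℂ] H) ≤ (y : H →L[ℂ] H)) D →
    ∀ a : M.toStarSubalgebra,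
      IsLUB ((fun x : M.toStarSubalgebra => (x : H →L[ℂ] H)) '' D) (a : H →L[ℂ] H) →
      IsLUB ((fun x : M.toStarSubalgebra => (Φ x : K →L[ℂ] K)) '' D) (Φ a : K →L[ℂ] K)

/-- The commutant of a set `S` of bounded operators together with their adjoints. -/
def commutantOf [CompleteSpace H] (S : Set (H →L[ℂ] H)) : VonNeumannAlgebra H where
  toStarSubalgebra := StarSubalgebra.centralizer ℂ S
  centralizer_centralizer' := by simp

/-- The reduced algebra `N p = {x p | x ∈ N}` for a projection `p` in the commutant of `N`
(its unit is `p`). -/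
def reducedAlgebra [CompleteSpace H] (N : VonNeumannAlgebra H) (p : H →L[ℂ] H)
    (hp : IsStarProjection p) (hpN : p ∈ N.commutant) : NonUnitalStarSubalgebra ℂ (H →L[ℂ] H) where
  carrier := {y | ∃ x ∈ N.toStarSubalgebra, y = x * p}
  add_mem' := by
    rintro _ _ ⟨x, hx, rfl⟩ ⟨y, hy, rfl⟩
    exact ⟨x + y, add_mem hx hy, (add_mul x y p).symm⟩
  zero_mem' := ⟨0, zero_mem _, (zero_mul p).symm⟩
  mul_mem' := by
    rintro _ _ ⟨x, hx, rfl⟩ ⟨y, hy, rfl⟩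
    have h : y * p = p * y := VonNeumannAlgebra.mem_commutant_iff.1 hpN y hy
    refine ⟨x * y, mul_mem hx hy, ?_⟩
    have hpp : p * p = p := hp.isIdempotentElem
    rw [mul_assoc, ← mul_assoc p y p, ← h, mul_assoc y p p, hpp, mul_assoc]
  smul_mem' := by
    rintro r _ ⟨x, hx, rfl⟩
    exact ⟨r • x, SMulMemClass.smul_mem r hx, (smul_mul_assoc r x p).symm⟩
  star_mem' := by
    rintro _ ⟨x, hx, rfl⟩
    have h : star x * p = p * star x := VonNeumannAlgebra.mem_commutant_iff.1 hpN _
      (star_mem (S := StarSubalgebra ℂ (H →L[ℂ] H)) hx)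
    refine ⟨star x, star_mem hx, ?_⟩
    rw [star_mul, hp.isSelfAdjoint.star_eq, h]

end Operators

section Tensor

/-- The Hilbert space tensor product: the completion of the algebraic tensor product with
respect to `⟪a ⊗ b, a' ⊗ b'⟫ = ⟪a, a'⟫ ⟪b, b'⟫`. -/
def HilbertTensor (H : Type u) (L : Type v) [NormedAddCommGroup H] [InnerProductSpace ℂ H]
    [NormedAddCommGroup L] [InnerProductSpace ℂ L] : Type (max u v) :=
  UniformSpace.Completion (H ⊗[ℂ] L)

variable {H : Type u} {L : Type v} [NormedAddCommGroup H] [InnerProductSpace ℂ H]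
  [NormedAddCommGroup L] [InnerProductSpace ℂ L]

instance : NormedAddCommGroup (HilbertTensor H L) :=
  inferInstanceAs (NormedAddCommGroup (UniformSpace.Completion (H ⊗[ℂ] L)))

instance : InnerProductSpace ℂ (HilbertTensor H L) :=
  inferInstanceAs (InnerProductSpace ℂ (UniformSpace.Completion (H ⊗[ℂ] L)))

instance : CompleteSpace (HilbertTensor H L) :=
  inferInstanceAs (CompleteSpace (UniformSpace.Completion (H ⊗[ℂ] L)))

/-- The elementary tensor `ξ ⊗ ζ` as an element of `H ⊗ L`. -/
def tmulHat (ξ : H) (ζ : L) : HilbertTensor H L :=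
  ((ξ ⊗ₜ[ℂ] ζ : H ⊗[ℂ] L) : UniformSpace.Completion (H ⊗[ℂ] L))

/-- The bounded operator `x ⊗ y` on `H ⊗ L`. -/
def tensorOp (x : H →L[ℂ] H) (y : L →L[ℂ] L) : HilbertTensor H L →L[ℂ] HilbertTensor H L :=
  (TensorProduct.mapL x y).completion

theorem inner_tmulHat (ξ ξ' : H) (ζ ζ' : L) :
    ⟪tmulHat ξ ζ, tmulHat ξ' ζ'⟫_ℂ = ⟪ξ, ξ'⟫_ℂ * ⟪ζ, ζ'⟫_ℂ := by
  refine (UniformSpace.Completion.inner_coe (𝕜 := ℂ) (ξ ⊗ₜ[ℂ] ζ) (ξ' ⊗ₜ[ℂ] ζ')).trans ?_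
  exact TensorProduct.inner_tmul ℂ ξ ξ' ζ ζ'

theorem tensorOp_tmulHat (x : H →L[ℂ] H) (y : L →L[ℂ] L) (ξ : H) (ζ : L) :
    tensorOp x y (tmulHat ξ ζ) = tmulHat (x ξ) (y ζ) := by
  change (TensorProduct.mapL x y).completion
    ((ξ ⊗ₜ[ℂ] ζ : H ⊗[ℂ] L) : UniformSpace.Completion (H ⊗[ℂ] L)) = _
  simp [tmulHat]

theorem Conjugation.inner_map (c : Conjugation H) (ξ ζ : H) : ⟪c ξ, c ζ⟫_ℂ = ⟪ζ, ξ⟫_ℂ := by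
  have hI : c (Complex.I • ζ) = -(Complex.I • c ζ) := by
    have h : c (Complex.I • ζ) = (starRingEnd ℂ Complex.I) • c ζ :=
      c.toLinearIsometry.toLinearMap.map_smulₛₗ Complex.I ζ
    rw [h, Complex.conj_I, neg_smul]
  have h1 : ‖c ξ + c ζ‖ = ‖ξ + ζ‖ := by rw [← map_add]; exact c.norm_map _
  have h2 : ‖c ξ - c ζ‖ = ‖ξ - ζ‖ := by rw [← map_sub]; exact c.norm_map _
  have h3 : ‖c ξ + Complex.I • c ζ‖ = ‖ξ - Complex.I • ζ‖ := by
    rw [← c.norm_map (ξ - Complex.I • ζ)]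
    refine congrArg norm (Eq.trans ?_ (map_sub c.toLinearIsometry ξ (Complex.I • ζ)).symm)
    rw [hI, sub_neg_eq_add]
  have h4 : ‖c ξ - Complex.I • c ζ‖ = ‖ξ + Complex.I • ζ‖ := by
    rw [← c.norm_map (ξ + Complex.I • ζ)]
    refine congrArg norm (Eq.trans ?_ (map_add c.toLinearIsometry ξ (Complex.I • ζ)).symm)
    rw [hI, sub_eq_add_neg]
  rw [← inner_conj_symm ζ ξ, inner_eq_sum_norm_sq_div_four (c ξ) (c ζ),
    inner_eq_sum_norm_sq_div_four ξ ζ]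
  simp only [RCLike.I_to_complex, Complex.coe_algebraMap] at *
  rw [h1, h2, h3, h4]
  simp only [map_div₀, map_add, map_sub, map_mul, map_pow, Complex.conj_ofReal, Complex.conj_I,
    map_ofNat]
  ring

/-- The conjugation `c ⊗ d` of `H ⊗ L`, with `(c ⊗ d) (ξ ⊗ ζ) = c ξ ⊗ d ζ`; its real form is
`Hʳ ⊗ Lʳ`. -/
def Conjugation.algTensor (c : Conjugation H) (d : Conjugation L) : H ⊗[ℂ] L →ₗᵢ⋆[ℂ] H ⊗[ℂ] L where
  toLinearMap := TensorProduct.map c.toLinearMap d.toLinearMap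
  norm_map' x := by
    have key : ∀ x y : H ⊗[ℂ] L,
        ⟪TensorProduct.map c.toLinearMap d.toLinearMap x,
          TensorProduct.map c.toLinearMap d.toLinearMap y⟫_ℂ = ⟪y, x⟫_ℂ := by
      intro x y
      induction x using TensorProduct.induction_on with
      | zero => simp
      | add a b ha hb => rw [map_add, inner_add_left, inner_add_right, ha, hb]
      | tmul a b =>
        induction y using TensorProduct.induction_on with
        | zero => simp
        | add a' b' ha hb => rw [map_add, inner_add_left, inner_add_right, ha, hb]
        | tmul a' b' =>
          rw [TensorProduct.map_tmul, TensorProduct.map_tmul, TensorProduct.inner_tmul,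
            TensorProduct.inner_tmul]
          exact congrArg₂ (· * ·) (c.inner_map a a') (d.inner_map b b')
    rw [@norm_eq_sqrt_re_inner ℂ, @norm_eq_sqrt_re_inner ℂ, key]

/-- The extension of `c ⊗ d` to the completion `UniformSpace.Completion (H ⊗[ℂ] L)`. -/
def Conjugation.tensorAux (c : Conjugation H) (d : Conjugation L) :
    Conjugation (UniformSpace.Completion (H ⊗[ℂ] L)) where
  toLinearMap := ((c.algTensor d).toContinuousLinearMap.completion).toLinearMap
  norm_map' x := by
    induction x using UniformSpace.Completion.induction_on with
    | hp => exact isClosed_eq (by fun_prop) (by fun_prop)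
    | ih a => simp
  involutive' x := by
    change ((c.algTensor d).toContinuousLinearMap.completion)
      (((c.algTensor d).toContinuousLinearMap.completion) x) = x
    induction x using UniformSpace.Completion.induction_on with
    | hp => exact isClosed_eq (by fun_prop) (by fun_prop)
    | ih a =>
      have h : ∀ a : H ⊗[ℂ] L, c.algTensor d (c.algTensor d a) = a := by
        intro a
        induction a using TensorProduct.induction_on with
        | zero => simp
        | add a b ha hb => rw [map_add, map_add, ha, hb]
        | tmul a b =>
          exact congrArg₂ (TensorProduct.tmul ℂ) (c.involutive' a) (d.involutive' b)
      simp [h]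

/-- The conjugation `c ⊗ d` of the Hilbert space tensor product. -/
def Conjugation.tensor (c : Conjugation H) (d : Conjugation L) :
    Conjugation (HilbertTensor H L) :=
  c.tensorAux d

theorem Conjugation.tensor_tmulHat (c : Conjugation H) (d : Conjugation L) (ξ : H) (ζ : L) :
    c.tensor d (tmulHat ξ ζ) = tmulHat (c ξ) (d ζ) := by
  change (c.algTensor d).toContinuousLinearMap.completion
    ((ξ ⊗ₜ[ℂ] ζ : H ⊗[ℂ] L) : UniformSpace.Completion (H ⊗[ℂ] L)) = _
  simp only [ContinuousLinearMap.completion_apply_coe]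
  rfl

variable (L) in
/-- The set of the operators `a ⊗ 1_L`, `a ∈ M`. -/
def amplifiedSet [CompleteSpace H] (M : VonNeumannAlgebra H) :
    Set (HilbertTensor H L →L[ℂ] HilbertTensor H L) :=
  {y | ∃ a ∈ M.toStarSubalgebra, y = tensorOp a (1 : L →L[ℂ] L)}

variable (L) in
/-- The von Neumann tensor product `M ⊗̄ ℂ1_L`: the von Neumann algebra (double commutant)
generated on `H ⊗ L` by the operators `a ⊗ 1_L`, `a ∈ M`, and their adjoints. -/
def amplification [CompleteSpace H] (M : VonNeumannAlgebra H) :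
    VonNeumannAlgebra (HilbertTensor H L) :=
  (commutantOf (amplifiedSet L M)).commutant

end Tensor

/-- A factorization `Φ = Φ₃ ∘ Φ₂ ∘ Φ₁` of a `*`-homomorphism `Φ : M₁ → M₂` with
`Φ ∘ α₁ = α₂ ∘ Φ` through an amplification by `L`, a reduction and a spatial isomorphism, in which
each factor intertwines the corresponding involutive `*`-antiautomorphisms. -/
structure Factorization
    {H₁ : Type u} [NormedAddCommGroup H₁] [InnerProductSpace ℂ H₁] [CompleteSpace H₁]
    {H₂ : Type v} [NormedAddCommGroup H₂] [InnerProductSpace ℂ H₂] [CompleteSpace H₂]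
    {M₁ : VonNeumannAlgebra H₁} {M₂ : VonNeumannAlgebra H₂}
    (α₁ : InvolutiveStarAntiAut M₁.toStarSubalgebra)
    (α₂ : InvolutiveStarAntiAut M₂.toStarSubalgebra)
    (Φ : M₁.toStarSubalgebra →⋆ₙₐ[ℂ] M₂.toStarSubalgebra)
    (L : Type v) [NormedAddCommGroup L] [InnerProductSpace ℂ L] [CompleteSpace L] where
  /-- The amplification `M₁ → M₁ ⊗̄ ℂ1_L`. -/
  Φ₁ : M₁.toStarSubalgebra →⋆ₐ[ℂ] (amplification L M₁).toStarSubalgebra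
  Φ₁_apply : ∀ a, (Φ₁ a : HilbertTensor H₁ L →L[ℂ] HilbertTensor H₁ L) =
    tensorOp (a : H₁ →L[ℂ] H₁) (1 : L →L[ℂ] L)
  Φ₁_surjective : Function.Surjective Φ₁
  /-- The antiautomorphism `α₁ ⊗ id` of `M₁ ⊗̄ ℂ1_L`. -/
  αt : InvolutiveStarAntiAut (amplification L M₁).toStarSubalgebra
  αt_apply : ∀ (a : M₁.toStarSubalgebra) (x : (amplification L M₁).toStarSubalgebra),
    (x : HilbertTensor H₁ L →L[ℂ] HilbertTensor H₁ L) =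
        tensorOp (a : H₁ →L[ℂ] H₁) (1 : L →L[ℂ] L) →
      (αt x : HilbertTensor H₁ L →L[ℂ] HilbertTensor H₁ L) =
        tensorOp (α₁ a : H₁ →L[ℂ] H₁) (1 : L →L[ℂ] L)
  Φ₁_intertwines : ∀ a, Φ₁ (α₁ a) = αt (Φ₁ a)
  /-- The projection in the commutant of `M₁ ⊗̄ ℂ1_L`. -/
  p : HilbertTensor H₁ L →L[ℂ] HilbertTensor H₁ L
  isStarProjection_p : IsStarProjection p
  p_mem : p ∈ (amplification L M₁).commutant
  /-- The reduction `x ↦ x p`. -/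
  Φ₂ : (amplification L M₁).toStarSubalgebra →⋆ₙₐ[ℂ]
    reducedAlgebra (amplification L M₁) p isStarProjection_p p_mem
  Φ₂_apply : ∀ x, (Φ₂ x : HilbertTensor H₁ L →L[ℂ] HilbertTensor H₁ L) = x * p
  Φ₂_surjective : Function.Surjective Φ₂
  /-- The antiautomorphism `x p ↦ (α₁ ⊗ id)(x) p` of the reduced algebra. -/
  αb : InvolutiveStarAntiAut (reducedAlgebra (amplification L M₁) p isStarProjection_p p_mem)
  αb_apply : ∀ (x : (amplification L M₁).toStarSubalgebra)
    (y : reducedAlgebra (amplification L M₁) p isStarProjection_p p_mem),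
    (y : HilbertTensor H₁ L →L[ℂ] HilbertTensor H₁ L) = x * p →
      (αb y : HilbertTensor H₁ L →L[ℂ] HilbertTensor H₁ L) = αt x * p
  Φ₂_intertwines : ∀ x, Φ₂ (αt x) = αb (Φ₂ x)
  /-- The spatial isomorphism of the reduced algebra onto the image of `Φ`. -/
  Φ₃ : reducedAlgebra (amplification L M₁) p isStarProjection_p p_mem →⋆ₙₐ[ℂ]
    M₂.toStarSubalgebra
  Φ₃_injective : Function.Injective Φ₃
  range_Φ₃ : Set.range Φ₃ = Set.range Φ
  /-- The partial isometry that maps the range of `p` unitarily onto the range of `Φ 1` and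
  implements `Φ₃`. -/
  u : HilbertTensor H₁ L →L[ℂ] H₂
  adjoint_u_comp_u : (ContinuousLinearMap.adjoint u).comp u = p
  u_comp_adjoint_u : u.comp (ContinuousLinearMap.adjoint u) = (Φ 1 : H₂ →L[ℂ] H₂)
  Φ₃_apply : ∀ y, (Φ₃ y : H₂ →L[ℂ] H₂) =
    (u.comp (y : HilbertTensor H₁ L →L[ℂ] HilbertTensor H₁ L)).comp
      (ContinuousLinearMap.adjoint u)
  Φ₃_intertwines : ∀ y, Φ₃ (αb y) = α₂ (Φ₃ y)
  factorization : ∀ a, Φ a = Φ₃ (Φ₂ (Φ₁ a))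

end RealW

end

/-! Everything reduces to one operator `u : H₁ ⊗ L → H₂` with `u (a ⊗ 1) = Φ(a) u` and `u u⋆ =
Φ(1)`. Given such a `u`, put `p' = u⋆u`. It is a projection in the commutant of the amplification,
and `y ↦ u y u⋆` is an isomorphism of the reduced algebra onto the image of `Φ`, because it sends
`(a ⊗ 1) p'` to `Φ(a)`. The image is stable under `α₂`, so `α₂` pulls back along this isomorphism to
the required antiautomorphism of the reduced algebra; invariance of `p'` plays no role in this.

To build `u`, take a vector `η` with `Φ(1)η ≠ 0`. Normality and two maximality arguments compare the
functional `⟪Φ(a)η, η⟫` with a vector functional of `H₁` and give `x ∈ M₁` and `ξ` such that `a x ξ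
↦ Φ(a x) η` is a well-defined contraction and `Φ(x)η ≠ 0` (`IsNormal.exists_norm_le`). It extends to
a nonzero intertwiner `H₁ → H₂` (`IsNormal.exists_intertwiner`), and polar decomposition replaces
that by an intertwining partial isometry (`IsIntertwiner.exists_partialIsometry`). Zorn's lemma then
gives partial isometries `V i` with orthogonal ranges filling `Φ(1)H₂` (`IsNormal.exists_family`).
They are the components `u (ξ ⊗ e i) = V i ξ` of `u`, where `e i` is the standard basis of `L = ℓ²`.

For real forms, the hypothesis amounts to `α(a) = c a⋆ c`. Then `W ↦ c₂ W c₁` preserves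
intertwiners, so every nonzero intertwiner has a nonzero real or imaginary part, and polar
decomposition keeps it real. A family of real `V i` gives a real `u`, hence a projection `u⋆u` fixed
by the transpose. -/

namespace RealW

/-! ### Bounded operators determined on the range of another operator. -/

section Extension

variable {E G F : Type*} [AddCommGroup E] [Module ℂ E]
  [NormedAddCommGroup G] [InnerProductSpace ℂ G] [CompleteSpace G]
  [NormedAddCommGroup F] [InnerProductSpace ℂ F]

/-- If `‖B x‖ ≤ ‖A x‖` for all `x`, then `B` factors through `A` by a bounded operator vanishing on
the orthogonal complement of the range of `A`. -/
theorem exists_factor_of_norm_le [CompleteSpace F] (A : E →ₗ[ℂ] G) (B : E →ₗ[ℂ] F)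
    (h : ∀ x, ‖B x‖ ≤ ‖A x‖) :
    ∃ W : G →L[ℂ] F, (∀ x, W (A x) = B x) ∧ ∀ y, (∀ x, ⟪A x, y⟫_ℂ = 0) → W y = 0 := by
  let R := LinearMap.range A
  have hker : LinearMap.ker A ≤ LinearMap.ker B := by
    intro x hx
    have := h x
    rw [LinearMap.mem_ker.1 hx, norm_zero] at this
    exact LinearMap.mem_ker.2 (norm_le_zero_iff.1 this)
  let f₀ : R →ₗ[ℂ] F := (Submodule.liftQ _ B hker).comp A.quotKerEquivRange.symm.toLinearMap
  have hf₀ : ∀ x, f₀ ⟨A x, x, rfl⟩ = B x := by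
    intro x
    have hx : A.quotKerEquivRange.symm ⟨A x, x, rfl⟩ = Submodule.Quotient.mk x := by
      rw [LinearEquiv.symm_apply_eq]; rfl
    change (Submodule.liftQ _ B hker) (A.quotKerEquivRange.symm ⟨A x, x, rfl⟩) = _
    rw [hx]; rfl
  have hf₀n : ∀ y : R, ‖f₀ y‖ ≤ 1 * ‖y‖ := by
    rintro ⟨_, x, rfl⟩
    rw [hf₀, one_mul]; exact h x
  let f : R →L[ℂ] F := f₀.mkContinuous 1 hf₀n
  let K := R.topologicalClosure
  let e : R →L[ℂ] K :=
    (Submodule.inclusion R.le_topologicalClosure).mkContinuous 1 fun y => by simp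
  have hd : DenseRange e := by
    rw [DenseRange, dense_iff_closure_eq]
    ext y
    simp only [Set.mem_univ, iff_true]
    rw [closure_subtype]
    have hy : (y : G) ∈ closure (R : Set G) := y.2
    convert hy using 2
    ext z
    constructor
    · rintro ⟨_, ⟨w, rfl⟩, rfl⟩; exact w.2
    · intro hz; exact ⟨e ⟨z, hz⟩, ⟨_, rfl⟩, rfl⟩
  have hui : IsUniformInducing e := by
    have : Isometry e := AddMonoidHomClass.isometry_of_norm e fun y => rfl
    exact this.isUniformInducing
  have : CompleteSpace K := R.isClosed_topologicalClosure.completeSpace_coe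
  let g : K →L[ℂ] F := f.extend e
  have hg : ∀ y : R, g (e y) = f y := fun y => f.extend_eq hd hui y
  refine ⟨g.comp K.orthogonalProjectionOnto, ?_, ?_⟩
  · intro x
    have hx : K.orthogonalProjectionOnto (A x) = e ⟨A x, x, rfl⟩ :=
      Submodule.orthogonalProjectionOnto_mem_subspace_eq_self (e ⟨A x, x, rfl⟩)
    rw [ContinuousLinearMap.comp_apply, hx, hg]
    exact hf₀ x
  · intro y hy
    have hyK : y ∈ Kᗮ := by
      rw [Submodule.orthogonal_closure]
      rintro _ ⟨x, rfl⟩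
      exact hy x
    rw [ContinuousLinearMap.comp_apply,
      Submodule.orthogonalProjectionOnto_eq_zero_iff.2 hyK, map_zero]

/-- Bounded operators agreeing on the range of `A` and on its orthogonal complement are equal. -/
theorem eq_of_eqOn_range_orthogonal (A : E →ₗ[ℂ] G) {S T : G →L[ℂ] F}
    (h : ∀ x, S (A x) = T (A x)) (h' : ∀ y, (∀ x, ⟪A x, y⟫_ℂ = 0) → S y = T y) : S = T := by
  let R := LinearMap.range A
  let K := R.topologicalClosure
  have : CompleteSpace K := R.isClosed_topologicalClosure.completeSpace_coe
  have hK : ∀ y ∈ K, S y = T y := by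
    intro y hy
    have hcl : IsClosed {y | S y = T y} := isClosed_eq S.continuous T.continuous
    refine closure_minimal ?_ hcl hy
    rintro _ ⟨x, rfl⟩
    exact h x
  ext y
  obtain ⟨a, ha, b, hb, rfl⟩ := K.exists_add_mem_mem_orthogonal y
  rw [map_add, map_add, hK a ha, h' b]
  intro x
  exact hb _ (R.le_topologicalClosure ⟨x, rfl⟩)

end Extension

/-! ### Quadratic forms and suprema of increasing families of operators. -/

section Monotone

open Filter Topology

variable {H : Type*} [NormedAddCommGroup H] [InnerProductSpace ℂ H]

theorem reApplyInnerSelf_nonneg {T : H →L[ℂ] H} (hT : 0 ≤ T) (ξ : H) :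
    0 ≤ T.reApplyInnerSelf ξ :=
  ((ContinuousLinearMap.nonneg_iff_isPositive T).1 hT).re_inner_nonneg_left ξ

theorem reApplyInnerSelf_sub (S T : H →L[ℂ] H) (ξ : H) :
    (S - T).reApplyInnerSelf ξ = S.reApplyInnerSelf ξ - T.reApplyInnerSelf ξ := by
  simp [ContinuousLinearMap.reApplyInnerSelf_apply, inner_sub_left]

theorem reApplyInnerSelf_add (S T : H →L[ℂ] H) (ξ : H) :
    (S + T).reApplyInnerSelf ξ = S.reApplyInnerSelf ξ + T.reApplyInnerSelf ξ := by
  simp [ContinuousLinearMap.reApplyInnerSelf_apply, inner_add_left]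

theorem reApplyInnerSelf_mono {S T : H →L[ℂ] H} (h : S ≤ T) (ξ : H) :
    S.reApplyInnerSelf ξ ≤ T.reApplyInnerSelf ξ := by
  have : 0 ≤ (T - S).reApplyInnerSelf ξ :=
    ((ContinuousLinearMap.le_def _ _).1 h).re_inner_nonneg_left ξ
  rw [reApplyInnerSelf_sub] at this
  linarith

variable [CompleteSpace H]

theorem le_iff_reApplyInnerSelf_le {S T : H →L[ℂ] H} (hS : IsSelfAdjoint S)
    (hT : IsSelfAdjoint T) : S ≤ T ↔ ∀ ξ, S.reApplyInnerSelf ξ ≤ T.reApplyInnerSelf ξ := by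
  refine ⟨reApplyInnerSelf_mono, fun h => ?_⟩
  rw [ContinuousLinearMap.le_def, ContinuousLinearMap.isPositive_def']
  refine ⟨hT.sub hS, fun ξ => ?_⟩
  rw [reApplyInnerSelf_sub]
  linarith [h ξ]

/-- With `S = √T`, `‖S (S ξ)‖² ≤ ‖S‖² ‖S ξ‖²`, and `‖S‖² = ‖T‖`, `‖S ξ‖² = ⟪T ξ, ξ⟫`. This upgrades
convergence of quadratic forms to strong convergence. -/
theorem norm_sq_apply_le {T : H →L[ℂ] H} (hT : 0 ≤ T) (ξ : H) :
    ‖T ξ‖ ^ 2 ≤ ‖T‖ * T.reApplyInnerSelf ξ := by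
  have hs : CFC.sqrt T * CFC.sqrt T = T := CFC.sqrt_mul_sqrt_self T hT
  have hsa : IsSelfAdjoint (CFC.sqrt T) := (CFC.sqrt_nonneg T).isSelfAdjoint
  have hq : T.reApplyInnerSelf ξ = ‖CFC.sqrt T ξ‖ ^ 2 := by
    rw [ContinuousLinearMap.reApplyInnerSelf_apply]
    conv_lhs => rw [← hs]
    rw [mul_apply_eq_comp, ← ContinuousLinearMap.adjoint_inner_right,
      ← ContinuousLinearMap.star_eq_adjoint, hsa.star_eq, inner_self_eq_norm_sq]
  have hn : ‖T‖ = ‖CFC.sqrt T‖ ^ 2 := by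
    conv_lhs => rw [← hs]
    rw [hsa.norm_mul_self]
  rw [hq, hn]
  conv_lhs => rw [← hs]
  rw [mul_apply_eq_comp, ← mul_pow]
  gcongr
  exact (CFC.sqrt T).le_opNorm _

/-- A bounded increasing family of positive operators has a supremum, which is attained
pointwise and commutes with everything that commutes with the family. -/
theorem exists_isLUB_of_directedOn {D : Set (H →L[ℂ] H)} (hne : D.Nonempty)
    (hD : DirectedOn (· ≤ ·) D) (hpos : ∀ h ∈ D, 0 ≤ h) {y : H →L[ℂ] H} (hy : ∀ h ∈ D, h ≤ y) :
    ∃ a, IsLUB D a ∧ (∀ ξ, IsLUB ((fun h => h.reApplyInnerSelf ξ) '' D) (a.reApplyInnerSelf ξ)) ∧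
      ∀ b, (∀ h ∈ D, b * h = h * b) → b * a = a * b := by
  have : Nonempty D := hne.to_subtype
  have : IsDirected D (· ≤ ·) := ⟨fun a b => by
    obtain ⟨c, hc, h1, h2⟩ := hD a a.2 b b.2
    exact ⟨⟨c, hc⟩, h1, h2⟩⟩
  have hmono : ∀ ξ, Monotone fun h : D => (h : H →L[ℂ] H).reApplyInnerSelf ξ :=
    fun ξ a b hab => reApplyInnerSelf_mono hab ξ
  have hbdd : ∀ ξ, BddAbove (Set.range fun h : D => (h : H →L[ℂ] H).reApplyInnerSelf ξ) := by
    refine fun ξ => ⟨y.reApplyInnerSelf ξ, ?_⟩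
    rintro _ ⟨h, rfl⟩
    exact reApplyInnerSelf_mono (hy h h.2) ξ
  have hconv := fun ξ => tendsto_atTop_ciSup (hmono ξ) (hbdd ξ)
  -- Increments are controlled by those of the bounded monotone real net of quadratic forms, so the
  -- net is strongly Cauchy.
  have hest : ∀ i j : D, i ≤ j → ∀ ξ, ‖(j : H →L[ℂ] H) ξ - (i : H →L[ℂ] H) ξ‖ ^ 2 ≤
      ‖y‖ * ((j : H →L[ℂ] H).reApplyInnerSelf ξ - (i : H →L[ℂ] H).reApplyInnerSelf ξ) := by
    intro i j hij ξ
    have h0 : (0 : H →L[ℂ] H) ≤ (j : H →L[ℂ] H) - i := sub_nonneg.2 hij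
    have h1 := norm_sq_apply_le h0 ξ
    rw [reApplyInnerSelf_sub] at h1
    refine h1.trans ?_
    have h2 : ‖(j : H →L[ℂ] H) - i‖ ≤ ‖y‖ := by
      refine CStarAlgebra.norm_le_norm_of_nonneg_of_le h0 ?_
      exact (sub_le_self _ (hpos i i.2)).trans (hy j j.2)
    have h3 := reApplyInnerSelf_nonneg h0 ξ
    rw [reApplyInnerSelf_sub] at h3
    gcongr
  have hcau : ∀ ξ, ∃ z, Tendsto (fun h : D => (h : H →L[ℂ] H) ξ) atTop (𝓝 z) := by
    intro ξ
    refine CompleteSpace.complete (f := map (fun h : D => (h : H →L[ℂ] H) ξ) atTop) ?_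
    rw [Metric.cauchy_iff]
    refine ⟨inferInstance, fun ε hε => ?_⟩
    set s := ⨆ h : D, (h : H →L[ℂ] H).reApplyInnerSelf ξ with hs
    -- Chosen so that `(‖y‖ + 1) δ = (ε / 2)²`; the `+ 1` covers `y = 0`.
    have hδ : 0 < (ε / 2) ^ 2 / (‖y‖ + 1) := by positivity
    obtain ⟨i, hi⟩ := ((hconv ξ).eventually (lt_mem_nhds (sub_lt_self s hδ))).exists
    have key : ∀ j : D, i ≤ j → ‖(j : H →L[ℂ] H) ξ - (i : H →L[ℂ] H) ξ‖ < ε / 2 := by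
      intro j hij
      refine lt_of_pow_lt_pow_left₀ 2 (by positivity) ((hest i j hij ξ).trans_lt ?_)
      have hj : (j : H →L[ℂ] H).reApplyInnerSelf ξ ≤ s := le_ciSup (hbdd ξ) j
      have hij' := hmono ξ hij
      simp only at hij'
      calc _ ≤ (‖y‖ + 1) * ((j : H →L[ℂ] H).reApplyInnerSelf ξ -
            (i : H →L[ℂ] H).reApplyInnerSelf ξ) := by
            gcongr
            linarith
        _ < (‖y‖ + 1) * ((ε / 2) ^ 2 / (‖y‖ + 1)) := by
            gcongr
            linarith
        _ = _ := by field_simp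
    refine ⟨_, image_mem_map (Ici_mem_atTop i), ?_⟩
    rintro _ ⟨j, hj, rfl⟩ _ ⟨k, hk, rfl⟩
    have h1 := key j hj
    have h2 := key k hk
    rw [dist_eq_norm]
    calc ‖(j : H →L[ℂ] H) ξ - (k : H →L[ℂ] H) ξ‖
        = ‖((j : H →L[ℂ] H) ξ - (i : H →L[ℂ] H) ξ) - ((k : H →L[ℂ] H) ξ - (i : H →L[ℂ] H) ξ)‖ := by
          congr 1; abel
      _ ≤ _ := norm_sub_le _ _
      _ < ε := by linarith
  choose f hf using hcau
  let a₀ : H →ₗ[ℂ] H := linearMapOfTendsto f (fun h : D => ((h : H →L[ℂ] H) : H →ₗ[ℂ] H))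
    (tendsto_pi_nhds.2 hf)
  let a : H →L[ℂ] H := a₀.mkContinuous ‖y‖ fun ξ => by
    refine le_of_tendsto (hf ξ).norm (Eventually.of_forall fun h => ?_)
    exact (h : H →L[ℂ] H).le_of_opNorm_le
      (CStarAlgebra.norm_le_norm_of_nonneg_of_le (hpos h h.2) (hy h h.2)) ξ
  have ha : ∀ ξ, Tendsto (fun h : D => (h : H →L[ℂ] H) ξ) atTop (𝓝 (a ξ)) := hf
  have haq : ∀ ξ, Tendsto (fun h : D => (h : H →L[ℂ] H).reApplyInnerSelf ξ) atTop
      (𝓝 (a.reApplyInnerSelf ξ)) := fun ξ =>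
    (RCLike.continuous_re.tendsto _).comp ((ha ξ).inner tendsto_const_nhds)
  have hlub : ∀ ξ, IsLUB ((fun h => h.reApplyInnerSelf ξ) '' D) (a.reApplyInnerSelf ξ) := by
    intro ξ
    rw [Set.image_eq_range]
    exact isLUB_of_tendsto_atTop (hmono ξ) (haq ξ)
  have hsa : IsSelfAdjoint a := by
    rw [ContinuousLinearMap.isSelfAdjoint_iff_isSymmetric]
    intro ξ η
    refine tendsto_nhds_unique ((ha ξ).inner (tendsto_const_nhds (x := η))) ?_
    refine ((tendsto_const_nhds (x := ξ)).inner (ha η)).congr fun h => ?_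
    exact (((ContinuousLinearMap.isSelfAdjoint_iff_isSymmetric).1
      (hpos h h.2).isSelfAdjoint) ξ η).symm
  refine ⟨a, ⟨?_, ?_⟩, hlub, ?_⟩
  · intro h hh
    rw [le_iff_reApplyInnerSelf_le (hpos h hh).isSelfAdjoint hsa]
    exact fun ξ => (hlub ξ).1 ⟨h, hh, rfl⟩
  · intro b hb
    obtain ⟨h, hh⟩ := hne
    have hbsa : IsSelfAdjoint b := ((hpos h hh).trans (hb hh)).isSelfAdjoint
    rw [le_iff_reApplyInnerSelf_le hsa hbsa]
    refine fun ξ => (hlub ξ).2 ?_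
    rintro _ ⟨k, hk, rfl⟩
    exact reApplyInnerSelf_mono (hb hk) ξ
  · intro b hb
    ext ξ
    refine tendsto_nhds_unique ((b.continuous.tendsto _).comp (ha ξ)) ?_
    refine (ha (b ξ)).congr fun h => ?_
    exact (DFunLike.congr_fun (hb h h.2) ξ).symm

end Monotone

/-! ### Membership through the double commutant. -/

section VonNeumann

variable {H : Type*} [NormedAddCommGroup H] [InnerProductSpace ℂ H] [CompleteSpace H]

theorem mem_of_commute_commutant {M : VonNeumannAlgebra H} {x : H →L[ℂ] H}
    (h : ∀ b ∈ M.commutant, b * x = x * b) : x ∈ M := by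
  rw [← M.commutant_commutant, VonNeumannAlgebra.mem_commutant_iff]
  exact h

theorem commute_sqrt {a b : H →L[ℂ] H} (h : b * a = a * b) :
    b * CFC.sqrt a = CFC.sqrt a * b :=
  ((show Commute a b from h.symm).cfcₙ_nnreal _).symm

theorem sqrt_mem {M : VonNeumannAlgebra H} {x : H →L[ℂ] H} (hx : x ∈ M) : CFC.sqrt x ∈ M :=
  mem_of_commute_commutant fun _ hb =>
    commute_sqrt (VonNeumannAlgebra.mem_commutant_iff.1 hb x hx).symm

end VonNeumann


/-! ### Normality, domination by a vector functional, and existence of intertwiners. -/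

section Intertwiner

variable {H₁ : Type*} [NormedAddCommGroup H₁] [InnerProductSpace ℂ H₁] [CompleteSpace H₁]
  {H₂ : Type*} [NormedAddCommGroup H₂] [InnerProductSpace ℂ H₂] [CompleteSpace H₂]
  {M₁ : VonNeumannAlgebra H₁} {M₂ : VonNeumannAlgebra H₂}
  {Φ : M₁.toStarSubalgebra →⋆ₙₐ[ℂ] M₂.toStarSubalgebra}

/-- The square root of `h` stays in `M₁`, so `h` is `s⋆ s` inside the algebra on which `Φ` is
defined. -/
theorem map_coe_nonneg {h : M₁.toStarSubalgebra} (hh : 0 ≤ (h : H₁ →L[ℂ] H₁)) :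
    0 ≤ (Φ h : H₂ →L[ℂ] H₂) := by
  let s : M₁.toStarSubalgebra := ⟨CFC.sqrt (h : H₁ →L[ℂ] H₁), sqrt_mem h.2⟩
  have hs : h = star s * s := by
    apply Subtype.ext
    change (h : H₁ →L[ℂ] H₁) = star (CFC.sqrt (h : H₁ →L[ℂ] H₁)) * CFC.sqrt (h : H₁ →L[ℂ] H₁)
    rw [(CFC.sqrt_nonneg (h : H₁ →L[ℂ] H₁)).isSelfAdjoint.star_eq,
      CFC.sqrt_mul_sqrt_self (h : H₁ →L[ℂ] H₁) hh]
  rw [hs, map_mul, map_star]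
  exact star_mul_self_nonneg (Φ s : H₂ →L[ℂ] H₂)

theorem map_coe_mono {h k : M₁.toStarSubalgebra} (hk : (h : H₁ →L[ℂ] H₁) ≤ k) :
    (Φ h : H₂ →L[ℂ] H₂) ≤ Φ k := by
  have h0 : 0 ≤ ((k - h : M₁.toStarSubalgebra) : H₁ →L[ℂ] H₁) := sub_nonneg.2 hk
  have := map_coe_nonneg (Φ := Φ) h0
  rw [map_sub] at this
  exact sub_nonneg.1 this

/-- Normality speaks of order suprema. These coincide with pointwise suprema of quadratic forms both
in `H₁` and in `H₂`, which is the form in which vector functionals see them. -/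
theorem IsNormal.exists_isLUB (hΦ : IsNormal Φ) {D : Set M₁.toStarSubalgebra} (hne : D.Nonempty)
    (hD : DirectedOn (fun x y : M₁.toStarSubalgebra => (x : H₁ →L[ℂ] H₁) ≤ y) D)
    (hpos : ∀ h ∈ D, 0 ≤ (h : H₁ →L[ℂ] H₁)) {y : M₁.toStarSubalgebra}
    (hy : ∀ h ∈ D, (h : H₁ →L[ℂ] H₁) ≤ y) :
    ∃ a : M₁.toStarSubalgebra,
      (∀ h ∈ D, (h : H₁ →L[ℂ] H₁) ≤ a) ∧ (a : H₁ →L[ℂ] H₁) ≤ y ∧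
      (∀ ξ, IsLUB ((fun h : M₁.toStarSubalgebra => (h : H₁ →L[ℂ] H₁).reApplyInnerSelf ξ) '' D)
        ((a : H₁ →L[ℂ] H₁).reApplyInnerSelf ξ)) ∧
      ∀ η, IsLUB ((fun h : M₁.toStarSubalgebra => (Φ h : H₂ →L[ℂ] H₂).reApplyInnerSelf η) '' D)
        ((Φ a : H₂ →L[ℂ] H₂).reApplyInnerSelf η) := by
  obtain ⟨a, ha, haq, hac⟩ := exists_isLUB_of_directedOn
    (D := (fun h : M₁.toStarSubalgebra => (h : H₁ →L[ℂ] H₁)) '' D) (hne.image _)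
    (by
      rintro _ ⟨h, hh, rfl⟩ _ ⟨k, hk, rfl⟩
      obtain ⟨l, hl, h1, h2⟩ := hD h hh k hk
      exact ⟨l, ⟨l, hl, rfl⟩, h1, h2⟩)
    (by rintro _ ⟨h, hh, rfl⟩; exact hpos h hh)
    (y := (y : H₁ →L[ℂ] H₁)) (by rintro _ ⟨h, hh, rfl⟩; exact hy h hh)
  have haM : a ∈ M₁ := mem_of_commute_commutant fun b hb => hac b (by
    rintro _ ⟨h, hh, rfl⟩
    exact (VonNeumannAlgebra.mem_commutant_iff.1 hb h h.2).symm)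
  obtain ⟨b, hb, hbq, -⟩ := exists_isLUB_of_directedOn
    (D := (fun h : M₁.toStarSubalgebra => (Φ h : H₂ →L[ℂ] H₂)) '' D) (hne.image _)
    (by
      rintro _ ⟨h, hh, rfl⟩ _ ⟨k, hk, rfl⟩
      obtain ⟨l, hl, h1, h2⟩ := hD h hh k hk
      exact ⟨Φ l, ⟨l, hl, rfl⟩, map_coe_mono h1, map_coe_mono h2⟩)
    (by rintro _ ⟨h, hh, rfl⟩; exact map_coe_nonneg (hpos h hh))
    (y := (Φ y : H₂ →L[ℂ] H₂)) (by rintro _ ⟨h, hh, rfl⟩; exact map_coe_mono (hy h hh))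
  have hab := (hΦ D hne (fun h hh => Subtype.ext (hpos h hh).isSelfAdjoint) hD ⟨a, haM⟩ ha).unique hb
  refine ⟨⟨a, haM⟩, fun h hh => ha.1 ⟨h, hh, rfl⟩, ha.2 ?_, fun ξ => ?_, fun η => ?_⟩
  · rintro _ ⟨h, hh, rfl⟩; exact hy h hh
  · have := haq ξ
    rwa [Set.image_image] at this
  · have := hbq η
    rwa [Set.image_image, ← hab] at this

/-- Zorn's lemma below a positive element, for properties that pass to increasing limits. -/
theorem IsNormal.exists_maximal (hΦ : IsNormal Φ) {y : M₁.toStarSubalgebra}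
    (hy : 0 ≤ (y : H₁ →L[ℂ] H₁)) (P : M₁.toStarSubalgebra → Prop) (P0 : P 0)
    (hP : ∀ (D : Set M₁.toStarSubalgebra) (a : M₁.toStarSubalgebra), (∀ h ∈ D, P h) →
      (∀ h ∈ D, (h : H₁ →L[ℂ] H₁) ≤ a) →
      (∀ ξ, IsLUB ((fun h : M₁.toStarSubalgebra => (h : H₁ →L[ℂ] H₁).reApplyInnerSelf ξ) '' D)
        ((a : H₁ →L[ℂ] H₁).reApplyInnerSelf ξ)) →
      (∀ η, IsLUB ((fun h : M₁.toStarSubalgebra => (Φ h : H₂ →L[ℂ] H₂).reApplyInnerSelf η) '' D)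
        ((Φ a : H₂ →L[ℂ] H₂).reApplyInnerSelf η)) → P a) :
    ∃ h : M₁.toStarSubalgebra, 0 ≤ (h : H₁ →L[ℂ] H₁) ∧ (h : H₁ →L[ℂ] H₁) ≤ y ∧ P h ∧
      ∀ k : M₁.toStarSubalgebra, 0 ≤ (k : H₁ →L[ℂ] H₁) → (h : H₁ →L[ℂ] H₁) + k ≤ y →
        P (h + k) → k = 0 := by
  let S : Set M₁.toStarSubalgebra :=
    {h | 0 ≤ (h : H₁ →L[ℂ] H₁) ∧ (h : H₁ →L[ℂ] H₁) ≤ y ∧ P h}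
  obtain ⟨m, -, hm⟩ := zorn_le_nonempty₀ S (fun c hc hchain z hz => by
    obtain ⟨a, h1, h2, h3, h4⟩ := hΦ.exists_isLUB (D := c) ⟨z, hz⟩ hchain.directedOn
      (fun h hh => (hc hh).1) (y := y) fun h hh => (hc hh).2.1
    exact ⟨a, ⟨(hc hz).1.trans (h1 z hz), h2, hP c a (fun h hh => (hc hh).2.2) h1 h3 h4⟩, h1⟩)
    0 ⟨le_rfl, hy, P0⟩
  refine ⟨m, hm.1.1, hm.1.2.1, hm.1.2.2, fun k hk hmk hPk => ?_⟩
  have hle : m ≤ m + k := by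
    change (m : H₁ →L[ℂ] H₁) ≤ (m : H₁ →L[ℂ] H₁) + k
    exact le_add_of_nonneg_right hk
  have := hm.eq_of_le (show m + k ∈ S from ⟨hm.1.1.trans hle, hmk, hPk⟩) hle
  exact left_eq_add.1 this

theorem reApplyInnerSelf_star_mul_self {H : Type*} [NormedAddCommGroup H]
    [InnerProductSpace ℂ H] [CompleteSpace H] (T : H →L[ℂ] H) (ξ : H) :
    (star T * T).reApplyInnerSelf ξ = ‖T ξ‖ ^ 2 := by
  rw [ContinuousLinearMap.reApplyInnerSelf_apply, mul_apply_eq_comp,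
    ContinuousLinearMap.star_eq_adjoint, ContinuousLinearMap.adjoint_inner_left,
    inner_self_eq_norm_sq]

/-- Both sides are homogeneous in `a`, so `a` may be scaled by `1 / (‖a‖ + 1)`; the order argument
below reaches only contractions. -/
theorem norm_le_of_contractions (x : M₁.toStarSubalgebra) (ξ : H₁) (η : H₂)
    (h : ∀ a : M₁.toStarSubalgebra, ‖(a : H₁ →L[ℂ] H₁)‖ ≤ 1 →
      ‖(Φ (a * x) : H₂ →L[ℂ] H₂) η‖ ≤ ‖((a * x : M₁.toStarSubalgebra) : H₁ →L[ℂ] H₁) ξ‖)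
    (a : M₁.toStarSubalgebra) :
    ‖(Φ (a * x) : H₂ →L[ℂ] H₂) η‖ ≤ ‖((a * x : M₁.toStarSubalgebra) : H₁ →L[ℂ] H₁) ξ‖ := by
  obtain ⟨c, hc, hca⟩ : ∃ c : ℂ, 0 < ‖c‖ ∧ ‖c‖ * ‖(a : H₁ →L[ℂ] H₁)‖ ≤ 1 := by
    have hr : 0 < ‖(a : H₁ →L[ℂ] H₁)‖ + 1 := by positivity
    refine ⟨((‖(a : H₁ →L[ℂ] H₁)‖ + 1)⁻¹ : ℝ), ?_, ?_⟩
    · rw [Complex.norm_real]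
      exact norm_pos_iff.2 (inv_ne_zero hr.ne')
    · rw [Complex.norm_real, norm_inv, Real.norm_eq_abs, abs_of_pos hr, inv_mul_le_iff₀ hr]
      linarith
  have h1 := h (c • a) (by
    change ‖c • (a : H₁ →L[ℂ] H₁)‖ ≤ 1
    rwa [norm_smul])
  have h2 : c • a * x = c • (a * x) := Subtype.ext (smul_mul_assoc c _ _)
  rw [h2, map_smul] at h1
  have h3 : ∀ (b : M₁.toStarSubalgebra) (ζ : H₁),
    ((c • b : M₁.toStarSubalgebra) : H₁ →L[ℂ] H₁) ζ = c • ((b : H₁ →L[ℂ] H₁) ζ) := fun _ _ => rfl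
  have h4 : ∀ (b : M₂.toStarSubalgebra) (ζ : H₂),
    ((c • b : M₂.toStarSubalgebra) : H₂ →L[ℂ] H₂) ζ = c • ((b : H₂ →L[ℂ] H₂) ζ) := fun _ _ => rfl
  rw [h3, h4, norm_smul, norm_smul] at h1
  exact le_of_mul_le_mul_left h1 hc

set_option maxHeartbeats 1000000 in
/-- A normal representation is locally dominated by a vector functional of the given one. -/
theorem IsNormal.exists_norm_le (hΦ : IsNormal Φ) {η : H₂}
    (hη : (Φ 1 : H₂ →L[ℂ] H₂) η ≠ 0) :
    ∃ (x : M₁.toStarSubalgebra) (ξ : H₁), (Φ x : H₂ →L[ℂ] H₂) η ≠ 0 ∧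
      ∀ a : M₁.toStarSubalgebra,
        ‖(Φ (a * x) : H₂ →L[ℂ] H₂) η‖ ≤ ‖((a * x : M₁.toStarSubalgebra) : H₁ →L[ℂ] H₁) ξ‖ := by
  have hq : ∀ a : M₁.toStarSubalgebra,
      (Φ (star a * a) : H₂ →L[ℂ] H₂).reApplyInnerSelf η = ‖(Φ a : H₂ →L[ℂ] H₂) η‖ ^ 2 := by
    intro a
    rw [map_mul, map_star]
    exact reApplyInnerSelf_star_mul_self (Φ a : H₂ →L[ℂ] H₂) η
  have hqadd : ∀ a b : M₁.toStarSubalgebra, (Φ (a + b) : H₂ →L[ℂ] H₂).reApplyInnerSelf η =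
      (Φ a : H₂ →L[ℂ] H₂).reApplyInnerSelf η + (Φ b : H₂ →L[ℂ] H₂).reApplyInnerSelf η := by
    intro a b
    rw [map_add]
    exact reApplyInnerSelf_add _ _ η
  have hq0 : (Φ 0 : H₂ →L[ℂ] H₂).reApplyInnerSelf η = 0 := by
    rw [map_zero]
    simp [ContinuousLinearMap.reApplyInnerSelf_apply]
  have hqpos : ∀ a : M₁.toStarSubalgebra, 0 ≤ (a : H₁ →L[ℂ] H₁) →
      0 ≤ (Φ a : H₂ →L[ℂ] H₂).reApplyInnerSelf η := fun a ha =>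
    reApplyInnerSelf_nonneg (map_coe_nonneg ha) η
  -- Write `φ(a) = ⟪Φ(a)η, η⟫`. Removing a maximal `n ≤ 1` with `φ(n) = 0` leaves `y = 1 - n` such
  -- that `φ` vanishes on no nonzero positive element below `y`, while `φ(y) = φ(1) > 0`.
  obtain ⟨n, hn0, hn1, hnη, hnmax⟩ := hΦ.exists_maximal (y := 1)
    (zero_le_one : (0 : H₁ →L[ℂ] H₁) ≤ 1)
    (fun h => (Φ h : H₂ →L[ℂ] H₂).reApplyInnerSelf η ≤ 0) hq0.le
    (fun D a hD _ _ h => (h η).2 (by rintro _ ⟨k, hk, rfl⟩; exact hD k hk))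
  set y : M₁.toStarSubalgebra := 1 - n with hydef
  have hy0 : 0 ≤ (y : H₁ →L[ℂ] H₁) := sub_nonneg.2 hn1
  have hymax : ∀ k : M₁.toStarSubalgebra, 0 ≤ (k : H₁ →L[ℂ] H₁) → (k : H₁ →L[ℂ] H₁) ≤ y →
      (Φ k : H₂ →L[ℂ] H₂).reApplyInnerSelf η ≤ 0 → k = 0 := by
    intro k hk hky hkη
    refine hnmax k hk (le_sub_iff_add_le'.1 hky) ?_
    rw [hqadd]
    linarith
  have hyη : 0 < (Φ y : H₂ →L[ℂ] H₂).reApplyInnerSelf η := by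
    have h1 : (Φ 1 : H₂ →L[ℂ] H₂).reApplyInnerSelf η = ‖(Φ 1 : H₂ →L[ℂ] H₂) η‖ ^ 2 := by
      rw [← hq, star_one, one_mul]
    have h2 : (1 : M₁.toStarSubalgebra) = n + y := by rw [hydef]; abel
    rw [h2, hqadd, ← h2] at h1
    have h3 : 0 < ‖(Φ 1 : H₂ →L[ℂ] H₂) η‖ := norm_pos_iff.2 hη
    nlinarith
  have hyne : (y : H₁ →L[ℂ] H₁) ≠ 0 := by
    intro h
    have : y = 0 := Subtype.ext h
    rw [this, hq0] at hyη
    exact lt_irrefl _ hyη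
  obtain ⟨ξ, hξ⟩ : ∃ ξ, (Φ y : H₂ →L[ℂ] H₂).reApplyInnerSelf η <
      (y : H₁ →L[ℂ] H₁).reApplyInnerSelf ξ := by
    obtain ⟨ζ, hζ⟩ : ∃ ζ, 0 < (y : H₁ →L[ℂ] H₁).reApplyInnerSelf ζ := by
      by_contra! hcon
      refine hyne (le_antisymm ?_ hy0)
      rw [le_iff_reApplyInnerSelf_le hy0.isSelfAdjoint (IsSelfAdjoint.zero _)]
      intro ζ
      simpa [ContinuousLinearMap.reApplyInnerSelf_apply] using hcon ζ
    set s := (y : H₁ →L[ℂ] H₁).reApplyInnerSelf ζ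
    set t := (Φ y : H₂ →L[ℂ] H₂).reApplyInnerSelf η
    -- The scaled vector gives the value `(t/s + 1)² s = t²/s + 2t + s > t`.
    refine ⟨((t / s + 1 : ℝ) : ℂ) • ζ, ?_⟩
    rw [ContinuousLinearMap.reApplyInnerSelf_smul]
    have h1 : 0 < t / s := div_pos hyη hζ
    have h2 : ‖((t / s + 1 : ℝ) : ℂ)‖ = t / s + 1 := by
      rw [Complex.norm_real, Real.norm_eq_abs, abs_of_pos (by linarith)]
    rw [h2]
    change t < (t / s + 1) ^ 2 * s
    have h3 : t / s * s = t := div_mul_cancel₀ _ hζ.ne'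
    nlinarith [mul_pos (mul_pos h1 h1) hζ, mul_pos h1 hζ]
  -- Exhaust the part of `y` where the vector functional of `ξ` is at most `φ`. It cannot be all of
  -- `y` by the choice of `ξ`. On every positive element below the remainder `k = y - h` the reverse
  -- inequality holds, since a violation could be added to `h`.
  obtain ⟨h, hh0, hhy, hhP, hhmax⟩ := hΦ.exists_maximal hy0
    (fun h => (h : H₁ →L[ℂ] H₁).reApplyInnerSelf ξ ≤ (Φ h : H₂ →L[ℂ] H₂).reApplyInnerSelf η)
    (by
      rw [hq0]
      simp [ContinuousLinearMap.reApplyInnerSelf_apply])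
    (fun D a hD _ h1 h2 => (h1 ξ).2 (by
      rintro _ ⟨k, hk, rfl⟩
      exact (hD k hk).trans ((h2 η).1 ⟨k, hk, rfl⟩)))
  set k : M₁.toStarSubalgebra := y - h with hkdef
  have hk0 : 0 ≤ (k : H₁ →L[ℂ] H₁) := sub_nonneg.2 hhy
  have hky : (k : H₁ →L[ℂ] H₁) ≤ y := sub_le_self _ hh0
  have hkη : 0 < (Φ k : H₂ →L[ℂ] H₂).reApplyInnerSelf η := by
    by_contra! hcon
    have h1 := hymax k hk0 hky hcon
    rw [hkdef, sub_eq_zero] at h1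
    rw [← h1] at hhP
    exact absurd hξ (not_lt.2 hhP)
  -- For a contraction `a`, `(a x)⋆ (a x) ≤ x² = k`, so the comparison below `k` becomes the desired
  -- norm inequality.
  let x : M₁.toStarSubalgebra := ⟨CFC.sqrt (k : H₁ →L[ℂ] H₁), sqrt_mem k.2⟩
  have hxsa : star x = x :=
    Subtype.ext (CFC.sqrt_nonneg (k : H₁ →L[ℂ] H₁)).isSelfAdjoint.star_eq
  have hxx : x * x = k := Subtype.ext (CFC.sqrt_mul_sqrt_self (k : H₁ →L[ℂ] H₁) hk0)
  have hcontr : ∀ a : M₁.toStarSubalgebra, ‖(a : H₁ →L[ℂ] H₁)‖ ≤ 1 →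
      ‖(Φ (a * x) : H₂ →L[ℂ] H₂) η‖ ≤ ‖((a * x : M₁.toStarSubalgebra) : H₁ →L[ℂ] H₁) ξ‖ := by
    intro a ha
    set b : M₁.toStarSubalgebra := star (a * x) * (a * x) with hb
    have hb0 : 0 ≤ (b : H₁ →L[ℂ] H₁) :=
      star_mul_self_nonneg ((a * x : M₁.toStarSubalgebra) : H₁ →L[ℂ] H₁)
    have hbk : (b : H₁ →L[ℂ] H₁) ≤ k := by
      have h1 : star (a : H₁ →L[ℂ] H₁) * a ≤ 1 := by
        rw [← CStarAlgebra.norm_le_one_iff_of_nonneg _ (star_mul_self_nonneg _),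
          CStarRing.norm_star_mul_self]
        exact mul_le_one₀ ha (norm_nonneg _) ha
      have h2 := star_left_conjugate_le_conjugate h1 (x : H₁ →L[ℂ] H₁)
      have h3 : (b : H₁ →L[ℂ] H₁) = star (x : H₁ →L[ℂ] H₁) *
          (star (a : H₁ →L[ℂ] H₁) * a) * x := by
        rw [hb]
        change star ((a : H₁ →L[ℂ] H₁) * x) * ((a : H₁ →L[ℂ] H₁) * x) = _
        rw [star_mul]
        simp only [mul_assoc]
      rw [h3]
      refine h2.trans (le_of_eq ?_)
      rw [mul_one]
      change ((star x * x : M₁.toStarSubalgebra) : H₁ →L[ℂ] H₁) = _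
      rw [hxsa, hxx]
    have hhb : (h : H₁ →L[ℂ] H₁) + b ≤ y := by
      have : (y : H₁ →L[ℂ] H₁) = h + k := by rw [hkdef]; simp
      rw [this]
      gcongr
    have hbq1 : (b : H₁ →L[ℂ] H₁).reApplyInnerSelf ξ =
        ‖((a * x : M₁.toStarSubalgebra) : H₁ →L[ℂ] H₁) ξ‖ ^ 2 :=
      reApplyInnerSelf_star_mul_self ((a * x : M₁.toStarSubalgebra) : H₁ →L[ℂ] H₁) ξ
    -- If the inequality failed, `h + b` would still satisfy the defining property of `h`;
    -- maximality then gives `b = 0`, where no strict inequality is possible.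
    refine le_of_not_gt fun hlt => ?_
    have hlt2 : (b : H₁ →L[ℂ] H₁).reApplyInnerSelf ξ <
        (Φ b : H₂ →L[ℂ] H₂).reApplyInnerSelf η := by
      rw [hbq1, hq]
      gcongr
    have hbz : b = 0 := by
      refine hhmax b hb0 hhb ?_
      rw [hqadd]
      change ((h : H₁ →L[ℂ] H₁) + (b : H₁ →L[ℂ] H₁)).reApplyInnerSelf ξ ≤ _
      rw [reApplyInnerSelf_add]
      linarith
    rw [hbz, hq0] at hlt2
    simp [ContinuousLinearMap.reApplyInnerSelf_apply] at hlt2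
  refine ⟨x, ξ, ?_, fun a => ?_⟩
  · intro hx
    have h1 := hq x
    rw [hxsa, hxx, hx, norm_zero] at h1
    norm_num at h1
    exact hkη.ne' h1
  · exact norm_le_of_contractions x ξ η hcontr a

variable (Φ) in
/-- Bounded operators that intertwine the given representation with `Φ`. -/
def IsIntertwiner (W : H₁ →L[ℂ] H₂) : Prop :=
  ∀ (a : M₁.toStarSubalgebra) (ξ : H₁), W ((a : H₁ →L[ℂ] H₁) ξ) = (Φ a : H₂ →L[ℂ] H₂) (W ξ)

theorem IsIntertwiner.adjoint_apply {W : H₁ →L[ℂ] H₂} (hW : IsIntertwiner Φ W)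
    (a : M₁.toStarSubalgebra) (η : H₂) :
    W.adjoint ((Φ a : H₂ →L[ℂ] H₂) η) = (a : H₁ →L[ℂ] H₁) (W.adjoint η) := by
  refine ext_inner_left ℂ fun ξ => ?_
  rw [ContinuousLinearMap.adjoint_inner_right, ← ContinuousLinearMap.adjoint_inner_left,
    ← ContinuousLinearMap.adjoint_inner_left, ContinuousLinearMap.adjoint_inner_right]
  have h1 : (Φ a : H₂ →L[ℂ] H₂).adjoint = (Φ (star a) : H₂ →L[ℂ] H₂) := by
    rw [map_star]; rfl
  have h2 : (a : H₁ →L[ℂ] H₁).adjoint = ((star a : M₁.toStarSubalgebra) : H₁ →L[ℂ] H₁) := rfl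
  rw [h1, h2, hW]

/-- `W` is the continuous extension of `a x ξ ↦ Φ(a x) η`, zero on the orthogonal complement of
these vectors. Its range lies in the closure of `Φ(M₁)η`, so it is orthogonal to the range of every
intertwiner `Z` with `Z⋆η = 0`; this lets an orthogonal family be enlarged. -/
theorem IsNormal.exists_intertwiner (hΦ : IsNormal Φ) {η : H₂}
    (hη : (Φ 1 : H₂ →L[ℂ] H₂) η ≠ 0) :
    ∃ W : H₁ →L[ℂ] H₂, IsIntertwiner Φ W ∧ W ≠ 0 ∧
      ∀ Z : H₁ →L[ℂ] H₂, IsIntertwiner Φ Z → Z.adjoint η = 0 → ∀ ξ, Z.adjoint (W ξ) = 0 := by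
  obtain ⟨x, ξ, hx, hle⟩ := hΦ.exists_norm_le hη
  let A : M₁.toStarSubalgebra →ₗ[ℂ] H₁ :=
    { toFun := fun a => ((a * x : M₁.toStarSubalgebra) : H₁ →L[ℂ] H₁) ξ
      map_add' := fun a b => by rw [add_mul]; rfl
      map_smul' := fun c a => by rw [smul_mul_assoc]; rfl }
  let B : M₁.toStarSubalgebra →ₗ[ℂ] H₂ :=
    { toFun := fun a => (Φ (a * x) : H₂ →L[ℂ] H₂) η
      map_add' := fun a b => by rw [add_mul, map_add]; rfl
      map_smul' := fun c a => by rw [smul_mul_assoc, map_smul]; rfl }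
  obtain ⟨W, hWA, hW0⟩ := exists_factor_of_norm_le A B hle
  have hBmul : ∀ a b, (Φ a : H₂ →L[ℂ] H₂) (B b) = B (a * b) := by
    intro a b
    change _ = (Φ (a * b * x) : H₂ →L[ℂ] H₂) η
    rw [mul_assoc, map_mul Φ a]
    rfl
  have hAmul : ∀ a b : M₁.toStarSubalgebra, (a : H₁ →L[ℂ] H₁) (A b) = A (a * b) := by
    intro a b
    change _ = ((a * b * x : M₁.toStarSubalgebra) : H₁ →L[ℂ] H₁) ξ
    rw [mul_assoc]
    rfl
  refine ⟨W, fun a => ?_, ?_, ?_⟩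
  · have : W.comp (a : H₁ →L[ℂ] H₁) = (Φ a : H₂ →L[ℂ] H₂).comp W := by
      refine eq_of_eqOn_range_orthogonal A (fun b => ?_) (fun z hz => ?_)
      · simp only [ContinuousLinearMap.comp_apply]
        rw [hAmul, hWA, hWA, hBmul]
      · simp only [ContinuousLinearMap.comp_apply]
        rw [hW0 z hz, map_zero, hW0]
        intro b
        rw [← ContinuousLinearMap.adjoint_inner_left]
        have h2 : (a : H₁ →L[ℂ] H₁).adjoint = ((star a : M₁.toStarSubalgebra) : H₁ →L[ℂ] H₁) :=
          rfl
        rw [h2, hAmul, hz]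
    exact fun ζ => DFunLike.congr_fun this ζ
  · intro h
    have h1 := hWA 1
    rw [h] at h1
    refine hx ?_
    have h2 : B 1 = (Φ x : H₂ →L[ℂ] H₂) η := by
      change (Φ (1 * x) : H₂ →L[ℂ] H₂) η = _
      rw [one_mul]
    rw [← h2, ← h1]
    rfl
  · intro Z hZ hZη
    have : (Z.adjoint).comp W = 0 := by
      refine eq_of_eqOn_range_orthogonal A (fun b => ?_) (fun z hz => ?_)
      · rw [ContinuousLinearMap.comp_apply, hWA]
        change Z.adjoint ((Φ (b * x) : H₂ →L[ℂ] H₂) η) = 0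
        rw [hZ.adjoint_apply, hZη, map_zero]
      · rw [ContinuousLinearMap.comp_apply, hW0 z hz, map_zero]
        rfl
    exact fun ζ => DFunLike.congr_fun this ζ

end Intertwiner


/-! ### Elementary tensors, operators `x ⊗ y`, and the amplified algebra. -/

section HilbertTensor

variable {H : Type u} {L : Type v} [NormedAddCommGroup H] [InnerProductSpace ℂ H]
  [NormedAddCommGroup L] [InnerProductSpace ℂ L]

theorem norm_tmulHat (ξ : H) (ζ : L) : ‖tmulHat ξ ζ‖ = ‖ξ‖ * ‖ζ‖ := by
  have h : ‖tmulHat ξ ζ‖ ^ 2 = (‖ξ‖ * ‖ζ‖) ^ 2 := by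
    have := inner_tmulHat ξ ξ ζ ζ
    rw [inner_self_eq_norm_sq_to_K, inner_self_eq_norm_sq_to_K, inner_self_eq_norm_sq_to_K] at this
    rw [mul_pow]
    exact_mod_cast this
  exact (pow_left_inj₀ (norm_nonneg _) (by positivity) two_ne_zero).1 h

theorem tmulHat_add_left (ξ ξ' : H) (ζ : L) :
    tmulHat (ξ + ξ') ζ = tmulHat ξ ζ + tmulHat ξ' ζ := by
  change ((((ξ + ξ') ⊗ₜ[ℂ] ζ : H ⊗[ℂ] L)) : UniformSpace.Completion (H ⊗[ℂ] L)) = _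
  rw [TensorProduct.add_tmul, UniformSpace.Completion.coe_add]
  rfl

theorem tmulHat_add_right (ξ : H) (ζ ζ' : L) :
    tmulHat ξ (ζ + ζ') = tmulHat ξ ζ + tmulHat ξ ζ' := by
  change (((ξ ⊗ₜ[ℂ] (ζ + ζ') : H ⊗[ℂ] L)) : UniformSpace.Completion (H ⊗[ℂ] L)) = _
  rw [TensorProduct.tmul_add, UniformSpace.Completion.coe_add]
  rfl

theorem tmulHat_smul_left (r : ℂ) (ξ : H) (ζ : L) : tmulHat (r • ξ) ζ = r • tmulHat ξ ζ := by
  change ((((r • ξ) ⊗ₜ[ℂ] ζ : H ⊗[ℂ] L)) : UniformSpace.Completion (H ⊗[ℂ] L)) = _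
  rw [← TensorProduct.smul_tmul', UniformSpace.Completion.coe_smul]
  rfl

theorem tmulHat_smul_right (r : ℂ) (ξ : H) (ζ : L) : tmulHat ξ (r • ζ) = r • tmulHat ξ ζ := by
  change (((ξ ⊗ₜ[ℂ] (r • ζ) : H ⊗[ℂ] L)) : UniformSpace.Completion (H ⊗[ℂ] L)) = _
  rw [TensorProduct.tmul_smul, UniformSpace.Completion.coe_smul]
  rfl

/-- The operator `ξ ↦ ξ ⊗ ζ`. -/
noncomputable def tmulRight (ζ : L) : H →L[ℂ] HilbertTensor H L :=
  LinearMap.mkContinuous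
    { toFun := fun ξ => tmulHat ξ ζ
      map_add' := fun ξ ξ' => tmulHat_add_left ξ ξ' ζ
      map_smul' := fun r ξ => tmulHat_smul_left r ξ ζ } ‖ζ‖
    fun ξ => by
      change ‖tmulHat ξ ζ‖ ≤ _
      rw [norm_tmulHat, mul_comm]

theorem tmulRight_apply (ξ : H) (ζ : L) : tmulRight ζ ξ = tmulHat ξ ζ := rfl

/-- The operator `ζ ↦ ξ ⊗ ζ`. -/
noncomputable def tmulLeft (ξ : H) : L →L[ℂ] HilbertTensor H L :=
  LinearMap.mkContinuous
    { toFun := fun ζ => tmulHat ξ ζ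
      map_add' := fun ζ ζ' => tmulHat_add_right ξ ζ ζ'
      map_smul' := fun r ζ => tmulHat_smul_right r ξ ζ } ‖ξ‖
    fun ζ => by
      change ‖tmulHat ξ ζ‖ ≤ _
      rw [norm_tmulHat]

theorem hilbertTensor_ext {F : Type*} [NormedAddCommGroup F] [NormedSpace ℂ F]
    {S T : HilbertTensor H L →L[ℂ] F} (h : ∀ ξ ζ, S (tmulHat ξ ζ) = T (tmulHat ξ ζ)) : S = T := by
  ext x
  change UniformSpace.Completion (H ⊗[ℂ] L) at x
  induction x using UniformSpace.Completion.induction_on with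
  | hp => exact isClosed_eq S.continuous T.continuous
  | ih a =>
    induction a using TensorProduct.induction_on with
    | zero => exact (map_zero S).trans (map_zero T).symm
    | tmul ξ ζ => exact h ξ ζ
    | add a b ha hb =>
      rw [UniformSpace.Completion.coe_add]
      exact (map_add S _ _).trans ((congrArg₂ (· + ·) ha hb).trans (map_add T _ _).symm)

theorem hilbertTensor_ext_inner {x y : HilbertTensor H L}
    (h : ∀ ξ ζ, ⟪x, tmulHat ξ ζ⟫_ℂ = ⟪y, tmulHat ξ ζ⟫_ℂ) : x = y := by
  have : innerSL ℂ x = innerSL ℂ y := hilbertTensor_ext h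
  exact ext_inner_right ℂ fun z => DFunLike.congr_fun this z

theorem tensorOp_mul (x x' : H →L[ℂ] H) (y y' : L →L[ℂ] L) :
    tensorOp x y * tensorOp x' y' = tensorOp (x * x') (y * y') := by
  refine hilbertTensor_ext fun ξ ζ => ?_
  rw [mul_apply_eq_comp, tensorOp_tmulHat, tensorOp_tmulHat, tensorOp_tmulHat]
  rfl

theorem tensorOp_one : tensorOp (1 : H →L[ℂ] H) (1 : L →L[ℂ] L) = 1 := by
  refine hilbertTensor_ext fun ξ ζ => ?_
  rw [tensorOp_tmulHat]
  rfl

theorem tensorOp_add_left (x x' : H →L[ℂ] H) (y : L →L[ℂ] L) :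
    tensorOp (x + x') y = tensorOp x y + tensorOp x' y := by
  refine hilbertTensor_ext fun ξ ζ => ?_
  rw [add_apply, tensorOp_tmulHat, tensorOp_tmulHat, tensorOp_tmulHat,
    ← tmulHat_add_left]
  rfl

theorem tensorOp_smul_left (r : ℂ) (x : H →L[ℂ] H) (y : L →L[ℂ] L) :
    tensorOp (r • x) y = r • tensorOp x y := by
  refine hilbertTensor_ext fun ξ ζ => ?_
  rw [smul_apply, tensorOp_tmulHat, tensorOp_tmulHat, ← tmulHat_smul_left]
  rfl

theorem star_tensorOp [CompleteSpace H] [CompleteSpace L] (x : H →L[ℂ] H) (y : L →L[ℂ] L) :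
    star (tensorOp x y) = tensorOp (star x) (star y) := by
  refine hilbertTensor_ext fun ξ ζ => ?_
  refine hilbertTensor_ext_inner fun ξ' ζ' => ?_
  rw [ContinuousLinearMap.star_eq_adjoint, ContinuousLinearMap.adjoint_inner_left,
    tensorOp_tmulHat, tensorOp_tmulHat, inner_tmulHat, inner_tmulHat,
    ContinuousLinearMap.star_eq_adjoint, ContinuousLinearMap.star_eq_adjoint,
    ContinuousLinearMap.adjoint_inner_left, ContinuousLinearMap.adjoint_inner_left]

theorem tensorOp_mul_one (x y : H →L[ℂ] H) :
    tensorOp (x * y) (1 : L →L[ℂ] L) = tensorOp x 1 * tensorOp y 1 := by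
  rw [tensorOp_mul, one_mul]

theorem tensorOp_zero_left (y : L →L[ℂ] L) : tensorOp (0 : H →L[ℂ] H) y = 0 := by
  have := tensorOp_smul_left (0 : ℂ) (0 : H →L[ℂ] H) y
  rwa [zero_smul, zero_smul] at this

theorem tensorOp_algebraMap (r : ℂ) :
    tensorOp (algebraMap ℂ (H →L[ℂ] H) r) (1 : L →L[ℂ] L) =
      algebraMap ℂ (HilbertTensor H L →L[ℂ] HilbertTensor H L) r := by
  rw [Algebra.algebraMap_eq_smul_one, tensorOp_smul_left, tensorOp_one,
    Algebra.algebraMap_eq_smul_one]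

theorem tensorOp_star_one [CompleteSpace H] [CompleteSpace L] (x : H →L[ℂ] H) :
    tensorOp (star x) (1 : L →L[ℂ] L) = star (tensorOp x 1) := by
  rw [star_tensorOp, star_one]

theorem tensorOp_one_injective [Nontrivial L] {x x' : H →L[ℂ] H}
    (h : tensorOp x (1 : L →L[ℂ] L) = tensorOp x' 1) : x = x' := by
  obtain ⟨ζ, hζ⟩ := exists_ne (0 : L)
  ext ξ
  have h1 : tmulHat (x ξ) ζ = tmulHat (x' ξ) ζ := by
    have := DFunLike.congr_fun h (tmulHat ξ ζ)
    rwa [tensorOp_tmulHat, tensorOp_tmulHat] at this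
  have h2 : tmulHat (x ξ - x' ξ) ζ = 0 := by
    have h3 : tmulRight ζ (x ξ) = tmulRight ζ (x' ξ) := h1
    rw [← tmulRight_apply, map_sub, h3, sub_self]
  have h3 := norm_tmulHat (x ξ - x' ξ) ζ
  rw [h2, norm_zero, eq_comm, mul_eq_zero, norm_eq_zero, norm_eq_zero] at h3
  exact sub_eq_zero.1 (h3.resolve_right hζ)

section Amplification

variable [CompleteSpace H] {M : VonNeumannAlgebra H}

theorem commutant_amplification :
    (amplification L M).commutant = commutantOf (amplifiedSet L M) :=
  VonNeumannAlgebra.commutant_commutant _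

variable [CompleteSpace L]

/-- The operators `a ⊗ 1` are closed under adjoints, so commuting with the adjoints is automatic. -/
theorem mem_commutant_amplification_iff {t : HilbertTensor H L →L[ℂ] HilbertTensor H L} :
    t ∈ (amplification L M).commutant ↔
      ∀ a : M.toStarSubalgebra, tensorOp (a : H →L[ℂ] H) 1 * t = t * tensorOp (a : H →L[ℂ] H) 1 := by
  rw [commutant_amplification]
  change t ∈ StarSubalgebra.centralizer ℂ (amplifiedSet L M) ↔ _
  rw [StarSubalgebra.mem_centralizer_iff]
  constructor
  · intro h a
    exact (h _ ⟨a, a.2, rfl⟩).1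
  · rintro h _ ⟨a, ha, rfl⟩
    refine ⟨h ⟨a, ha⟩, ?_⟩
    rw [star_tensorOp, star_one]
    exact h (star ⟨a, ha⟩)

theorem tensorOp_mem_amplification (a : M.toStarSubalgebra) :
    tensorOp (a : H →L[ℂ] H) (1 : L →L[ℂ] L) ∈ amplification L M := by
  rw [← VonNeumannAlgebra.commutant_commutant (amplification L M),
    VonNeumannAlgebra.mem_commutant_iff]
  intro t ht
  exact (mem_commutant_amplification_iff.1 ht a).symm

/-- The algebra `M ⊗̄ ℂ1` consists of the operators `a ⊗ 1`. -/
theorem exists_eq_tensorOp [Nontrivial L] {t : HilbertTensor H L →L[ℂ] HilbertTensor H L}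
    (ht : t ∈ amplification L M) :
    ∃ a : M.toStarSubalgebra, t = tensorOp (a : H →L[ℂ] H) 1 := by
  have hcomm : ∀ s ∈ (amplification L M).commutant, s * t = t * s := by
    rw [← VonNeumannAlgebra.commutant_commutant (amplification L M)] at ht
    exact VonNeumannAlgebra.mem_commutant_iff.1 ht
  obtain ⟨e, he⟩ := exists_norm_eq L zero_le_one
  let a : H →L[ℂ] H := (tmulRight e).adjoint.comp (t.comp (tmulRight e))
  have hta : t = tensorOp a 1 := by
    refine hilbertTensor_ext fun ξ f => ?_
    -- `1 ⊗ y` lies in the commutant and moves `ξ ⊗ e` to `ξ ⊗ f`. Commuting `t` past it shows that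
    -- `t (ξ ⊗ f)` is determined by the corner `a` of `t` at `e`.
    let y : L →L[ℂ] L := (innerSL ℂ e).smulRight f
    have hy : ∀ ζ, y ζ = ⟪e, ζ⟫_ℂ • f := fun ζ => rfl
    have h1 : tensorOp (1 : H →L[ℂ] H) y * t = t * tensorOp 1 y := by
      refine hcomm _ (mem_commutant_amplification_iff.2 fun a => ?_)
      rw [tensorOp_mul, tensorOp_mul, one_mul, mul_one, one_mul, mul_one]
    have h2 : tensorOp (1 : H →L[ℂ] H) y = (tmulRight f).comp (tmulRight e).adjoint := by
      refine hilbertTensor_ext fun ξ ζ => ?_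
      have h3 : (tmulRight e).adjoint (tmulHat ξ ζ) = ⟪e, ζ⟫_ℂ • ξ := by
        refine ext_inner_left ℂ fun ξ' => ?_
        rw [ContinuousLinearMap.adjoint_inner_right, tmulRight_apply, inner_tmulHat,
          inner_smul_right, mul_comm]
      rw [tensorOp_tmulHat, ContinuousLinearMap.comp_apply, h3, map_smul, hy, tmulHat_smul_right]
      rfl
    have h3 := DFunLike.congr_fun h1 (tmulHat ξ e)
    rw [mul_apply_eq_comp, mul_apply_eq_comp, tensorOp_tmulHat, hy, inner_self_eq_norm_sq_to_K,
      he, h2] at h3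
    simp only [RCLike.ofReal_one, one_pow, one_smul] at h3
    rw [tensorOp_tmulHat]
    exact h3.symm
  refine ⟨⟨a, ?_⟩, hta⟩
  rw [VonNeumannAlgebra.mem_carrier, SetLike.mem_coe, ← M.commutant_commutant,
    VonNeumannAlgebra.mem_commutant_iff]
  intro b hb
  -- Commutation with `b ⊗ 1` for `b ∈ M'` puts the corner `a` into `M'' = M`.
  have h1 := hcomm (tensorOp b 1) (mem_commutant_amplification_iff.2 fun a => by
    rw [tensorOp_mul, tensorOp_mul, VonNeumannAlgebra.mem_commutant_iff.1 hb a a.2])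
  rw [hta, tensorOp_mul, tensorOp_mul, one_mul] at h1
  exact tensorOp_one_injective h1

end Amplification

end HilbertTensor


/-! ### Conjugations and real forms. -/

section Conjugations

variable {H : Type*} [NormedAddCommGroup H] [InnerProductSpace ℂ H]
  {K : Type*} [NormedAddCommGroup K] [InnerProductSpace ℂ K]

theorem Conjugation.apply_apply (c : Conjugation H) (ξ : H) : c (c ξ) = ξ := c.involutive' ξ

theorem Conjugation.map_smul_conj (c : Conjugation H) (r : ℂ) (ξ : H) :
    c (r • ξ) = (starRingEnd ℂ r) • c ξ :=
  c.toLinearIsometry.toLinearMap.map_smulₛₗ r ξ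

theorem Conjugation.inner_apply_left (c : Conjugation H) (ξ ζ : H) : ⟪c ξ, ζ⟫_ℂ = ⟪c ζ, ξ⟫_ℂ := by
  conv_lhs => rw [← c.apply_apply ζ]
  rw [c.inner_map]

theorem Conjugation.inner_apply_right (c : Conjugation H) (ξ ζ : H) :
    ⟪ξ, c ζ⟫_ℂ = ⟪ζ, c ξ⟫_ℂ := by
  conv_lhs => rw [← c.apply_apply ξ]
  rw [c.inner_map]

/-- The complex linear operator `d x c`. -/
noncomputable def Conjugation.conjOp (c : Conjugation H) (d : Conjugation K) (x : H →L[ℂ] K) :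
    H →L[ℂ] K :=
  d.toLinearIsometry.toContinuousLinearMap.comp
    (x.comp c.toLinearIsometry.toContinuousLinearMap)

theorem Conjugation.conjOp_apply (c : Conjugation H) (d : Conjugation K) (x : H →L[ℂ] K) (ξ : H) :
    c.conjOp d x ξ = d (x (c ξ)) := rfl

theorem Conjugation.sandwich_apply (c : Conjugation H) (x : H →L[ℂ] H) (ξ : H) :
    c.sandwich x ξ = c (x (c ξ)) := rfl

theorem Conjugation.commutes_iff {c : Conjugation H} {d : Conjugation K} {x : H →L[ℂ] K} :
    (∀ ξ, x (c ξ) = d (x ξ)) ↔ c.conjOp d x = x := by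
  constructor
  · intro h
    ext ξ
    rw [Conjugation.conjOp_apply, h, d.apply_apply]
  · intro h ξ
    conv_rhs => rw [← h]
    rw [Conjugation.conjOp_apply, d.apply_apply]

theorem Conjugation.adjoint_commutes [CompleteSpace H] [CompleteSpace K] {c : Conjugation H}
    {d : Conjugation K} {x : H →L[ℂ] K} (h : ∀ ξ, x (c ξ) = d (x ξ)) (η : K) :
    x.adjoint (d η) = c (x.adjoint η) := by
  refine ext_inner_left ℂ fun ξ => ?_
  rw [ContinuousLinearMap.adjoint_inner_right, d.inner_apply_right, ← h, c.inner_apply_right,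
    ContinuousLinearMap.adjoint_inner_left]

/-- The elements with `α x = x⋆` commute with `c`, and `M` is the complexification of this real
algebra. Conjugate-linearity of `c` then yields `c a = α(a)⋆ c` for every `a`. -/
theorem ActsOnRealForm.apply_conj [CompleteSpace H] {M : VonNeumannAlgebra H}
    {α : InvolutiveStarAntiAut M.toStarSubalgebra} {c : Conjugation H}
    (h : ActsOnRealForm M α c) (a : M.toStarSubalgebra) (ζ : H) :
    c ((a : H →L[ℂ] H) ζ) = (star (α a) : H →L[ℂ] H) (c ζ) := by
  -- The vectors `ζ + cζ` and `i(ζ - cζ)` are fixed by `c`, and together they recover `ζ`.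
  have hreal : ∀ x : M.toStarSubalgebra, α x = star x →
      ∀ ζ : H, c ((x : H →L[ℂ] H) ζ) = (x : H →L[ℂ] H) (c ζ) := by
    intro x hx ζ
    have h1 := h x hx (ζ + c ζ) (by rw [map_add, c.apply_apply, add_comm])
    have h2 := h x hx (Complex.I • (ζ - c ζ)) (by
      rw [c.map_smul_conj, map_sub, c.apply_apply, Complex.conj_I, neg_smul, ← smul_neg, neg_sub])
    rw [map_smul, c.map_smul_conj, Complex.conj_I, neg_smul, ← smul_neg] at h2
    have h3 := smul_right_injective H Complex.I_ne_zero h2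
    simp only [map_add, map_sub] at h1 h3
    have h4 : (2 : ℂ) • c ((x : H →L[ℂ] H) ζ) = (2 : ℂ) • (x : H →L[ℂ] H) (c ζ) := by
      rw [two_smul, two_smul]
      have h5 : c ((x : H →L[ℂ] H) ζ) = (x : H →L[ℂ] H) ζ + (x : H →L[ℂ] H) (c ζ) -
        c ((x : H →L[ℂ] H) (c ζ)) := eq_sub_of_add_eq h1
      have h6 : c ((x : H →L[ℂ] H) ζ) = c ((x : H →L[ℂ] H) (c ζ)) -
          ((x : H →L[ℂ] H) ζ - (x : H →L[ℂ] H) (c ζ)) := by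
        rw [← h3]; abel
      nth_rw 1 [h5]
      rw [h6]
      abel
    exact smul_right_injective H two_ne_zero h4
  have hαα : α (α a) = a := α.involutive' a
  have hαs : ∀ x, α (star x) = star (α x) := α.map_star'
  -- Twice the real part of `a`; the next element, `i(a - α(a)⋆)`, is up to sign twice the imaginary
  -- part.
  have h1 := hreal (a + star (α a)) (by
    rw [map_add, hαs, hαα, star_add, star_star, add_comm]) ζ
  have h2 := hreal (Complex.I • (a - star (α a))) (by
    rw [map_smul, map_sub, hαs, hαα, star_smul, star_sub, star_star, Complex.star_def,
      Complex.conj_I, neg_smul, ← smul_neg, neg_sub]) ζ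
  have h3 : c ((a : H →L[ℂ] H) ζ) + c ((star (α a) : H →L[ℂ] H) ζ) =
      (a : H →L[ℂ] H) (c ζ) + (star (α a) : H →L[ℂ] H) (c ζ) := by
    rw [← map_add]; exact h1
  have h4 : -(c ((a : H →L[ℂ] H) ζ) - c ((star (α a) : H →L[ℂ] H) ζ)) =
      (a : H →L[ℂ] H) (c ζ) - (star (α a) : H →L[ℂ] H) (c ζ) := by
    refine smul_right_injective H Complex.I_ne_zero ?_
    change Complex.I • -(c ((a : H →L[ℂ] H) ζ) - c ((star (α a) : H →L[ℂ] H) ζ)) =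
      Complex.I • ((a : H →L[ℂ] H) (c ζ) - (star (α a) : H →L[ℂ] H) (c ζ))
    rw [smul_neg, ← neg_smul, ← Complex.conj_I, ← map_sub, ← c.map_smul_conj]
    exact h2
  refine smul_right_injective H (two_ne_zero (α := ℂ)) ?_
  change (2 : ℂ) • _ = (2 : ℂ) • _
  rw [two_smul, two_smul]
  have h5 := eq_sub_of_add_eq h3
  have h6 : c ((a : H →L[ℂ] H) ζ) = c ((star (α a) : H →L[ℂ] H) ζ) -
      ((a : H →L[ℂ] H) (c ζ) - (star (α a) : H →L[ℂ] H) (c ζ)) := by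
    rw [← h4]; abel
  nth_rw 1 [h5]
  rw [h6]
  abel

end Conjugations

/-! ### Polar decomposition of intertwiners and the maximal orthogonal family. -/

section Polar

variable {H₁ : Type*} [NormedAddCommGroup H₁] [InnerProductSpace ℂ H₁] [CompleteSpace H₁]
  {H₂ : Type*} [NormedAddCommGroup H₂] [InnerProductSpace ℂ H₂] [CompleteSpace H₂]
  {M₁ : VonNeumannAlgebra H₁} {M₂ : VonNeumannAlgebra H₂}
  {Φ : M₁.toStarSubalgebra →⋆ₙₐ[ℂ] M₂.toStarSubalgebra}

/-- The partial isometry in the polar decomposition of an intertwiner is an intertwiner, and it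
respects every pair of conjugations that the given operator respects. -/
theorem IsIntertwiner.exists_partialIsometry {W : H₁ →L[ℂ] H₂} (hW : IsIntertwiner Φ W)
    (hne : W ≠ 0) :
    ∃ V : H₁ →L[ℂ] H₂, IsIntertwiner Φ V ∧ V ≠ 0 ∧ (∀ ξ, V (V.adjoint (V ξ)) = V ξ) ∧
      (∀ Z : H₁ →L[ℂ] H₂, (∀ ξ, Z.adjoint (W ξ) = 0) → ∀ ξ, Z.adjoint (V ξ) = 0) ∧
      ∀ (c₁ : Conjugation H₁) (c₂ : Conjugation H₂), (∀ ξ, W (c₁ ξ) = c₂ (W ξ)) →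
        ∀ ξ, V (c₁ ξ) = c₂ (V ξ) := by
  set Q : H₁ →L[ℂ] H₁ := W.adjoint.comp W with hQ
  have hQ0 : 0 ≤ Q :=
    (ContinuousLinearMap.nonneg_iff_isPositive _).2
      (ContinuousLinearMap.isPositive_adjoint_comp_self W)
  -- `T = |W|`; since `‖W ξ‖ = ‖T ξ‖`, the map `T ξ ↦ W ξ` defines `V`. As `W⋆W` commutes with `M₁`,
  -- so does `T`.
  set T : H₁ →L[ℂ] H₁ := CFC.sqrt Q with hT
  have hT0 : 0 ≤ T := CFC.sqrt_nonneg Q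
  have hTT : T * T = Q := CFC.sqrt_mul_sqrt_self Q hQ0
  have hTsymm : ∀ ξ ζ, ⟪T ξ, ζ⟫_ℂ = ⟪ξ, T ζ⟫_ℂ :=
    ContinuousLinearMap.isSelfAdjoint_iff_isSymmetric.1 hT0.isSelfAdjoint
  have hTW : ∀ ξ ζ, ⟪T ξ, T ζ⟫_ℂ = ⟪W ξ, W ζ⟫_ℂ := by
    intro ξ ζ
    rw [hTsymm, ← mul_apply_eq_comp, hTT, hQ, ContinuousLinearMap.comp_apply,
      ContinuousLinearMap.adjoint_inner_right]
  have hnorm : ∀ ξ, ‖W ξ‖ = ‖T ξ‖ := by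
    intro ξ
    rw [@norm_eq_sqrt_re_inner ℂ, @norm_eq_sqrt_re_inner ℂ, hTW]
  obtain ⟨V, hVT, hV0⟩ := exists_factor_of_norm_le (T : H₁ →ₗ[ℂ] H₁) (W : H₁ →ₗ[ℂ] H₂)
    fun ξ => (hnorm ξ).le
  have hVT' : ∀ ξ, V (T ξ) = W ξ := hVT
  have hV0' : ∀ y, (∀ x, ⟪T x, y⟫_ℂ = 0) → V y = 0 := hV0
  have hTcomm : ∀ (a : M₁.toStarSubalgebra) (ξ : H₁),
      T ((a : H₁ →L[ℂ] H₁) ξ) = (a : H₁ →L[ℂ] H₁) (T ξ) := by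
    intro a ξ
    have h1 : (a : H₁ →L[ℂ] H₁) * Q = Q * a := by
      ext ζ
      change (a : H₁ →L[ℂ] H₁) (W.adjoint (W ζ)) = W.adjoint (W ((a : H₁ →L[ℂ] H₁) ζ))
      rw [hW, hW.adjoint_apply]
    exact (DFunLike.congr_fun (commute_sqrt h1) ξ).symm
  refine ⟨V, fun a => ?_, ?_, ?_, ?_, ?_⟩
  · have : V.comp (a : H₁ →L[ℂ] H₁) = (Φ a : H₂ →L[ℂ] H₂).comp V := by
      refine eq_of_eqOn_range_orthogonal (T : H₁ →ₗ[ℂ] H₁) (fun x => ?_) (fun y hy => ?_)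
      · change V ((a : H₁ →L[ℂ] H₁) (T x)) = (Φ a : H₂ →L[ℂ] H₂) (V (T x))
        rw [← hTcomm, hVT', hVT', hW]
      · change V ((a : H₁ →L[ℂ] H₁) y) = (Φ a : H₂ →L[ℂ] H₂) (V y)
        rw [hV0 y hy, map_zero]
        refine hV0' _ fun x => ?_
        rw [← ContinuousLinearMap.adjoint_inner_left]
        have h2 : (a : H₁ →L[ℂ] H₁).adjoint = ((star a : M₁.toStarSubalgebra) : H₁ →L[ℂ] H₁) :=
          rfl
        rw [h2, ← hTcomm]
        exact hy _
    exact fun ξ => DFunLike.congr_fun this ξ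
  · rintro rfl
    refine hne ?_
    ext ξ
    rw [← hVT' ξ]
    rfl
  · have h1 : ∀ x, V.adjoint (V (T x)) = T x := by
      intro x
      -- The difference is orthogonal to the range of `T`, so `V` kills it; pairing it with itself
      -- then gives zero.
      have h2 : V.adjoint (W x) - T x = 0 := by
        have h3 : ∀ z, ⟪T z, V.adjoint (W x) - T x⟫_ℂ = 0 := by
          intro z
          rw [inner_sub_right, ContinuousLinearMap.adjoint_inner_right, hVT', hTW, sub_self]
        have h4 : ⟪V.adjoint (W x) - T x, V.adjoint (W x) - T x⟫_ℂ = 0 := by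
          conv_lhs => rw [inner_sub_left]
          rw [h3, sub_zero, ContinuousLinearMap.adjoint_inner_left, hV0' _ h3, inner_zero_right]
        exact inner_self_eq_zero.1 h4
      rw [hVT']
      exact sub_eq_zero.1 h2
    have : V.comp (V.adjoint.comp V) = V := by
      refine eq_of_eqOn_range_orthogonal (T : H₁ →ₗ[ℂ] H₁) (fun x => ?_) (fun y hy => ?_)
      · change V (V.adjoint (V (T x))) = V (T x)
        rw [h1]
      · change V (V.adjoint (V y)) = V y
        rw [hV0 y hy, map_zero, map_zero]
    exact fun ξ => DFunLike.congr_fun this ξ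
  · intro Z hZ
    have : Z.adjoint.comp V = 0 := by
      refine eq_of_eqOn_range_orthogonal (T : H₁ →ₗ[ℂ] H₁) (fun x => ?_) (fun y hy => ?_)
      · change Z.adjoint (V (T x)) = 0
        rw [hVT', hZ]
      · change Z.adjoint (V y) = 0
        rw [hV0 y hy, map_zero]
    exact fun ξ => DFunLike.congr_fun this ξ
  · intro c₁ c₂ hc
    have hTc : ∀ ξ, T (c₁ ξ) = c₁ (T ξ) := by
      rw [Conjugation.commutes_iff]
      symm
      -- `c₁ T c₁` is positive with square `c₁ Q c₁ = Q`, so it is `T` by uniqueness of the positive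
      -- square root.
      refine CFC.sqrt_unique (A := H₁ →L[ℂ] H₁) ?_ ?_
      · ext ξ
        change c₁ (T (c₁ (c₁ (T (c₁ ξ))))) = Q ξ
        rw [c₁.apply_apply, ← mul_apply_eq_comp, hTT]
        change c₁ (W.adjoint (W (c₁ ξ))) = W.adjoint (W ξ)
        rw [hc, Conjugation.adjoint_commutes hc, c₁.apply_apply]
      · rw [ContinuousLinearMap.nonneg_iff_isPositive, ContinuousLinearMap.isPositive_iff_complex]
        intro ξ
        have h1 : ⟪c₁.conjOp c₁ T ξ, ξ⟫_ℂ = ⟪T (c₁ ξ), c₁ ξ⟫_ℂ := by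
          rw [Conjugation.conjOp_apply, c₁.inner_apply_left, hTsymm]
        rw [h1]
        exact (ContinuousLinearMap.isPositive_iff_complex T).1
          ((ContinuousLinearMap.nonneg_iff_isPositive T).1 hT0) (c₁ ξ)
    rw [Conjugation.commutes_iff]
    refine eq_of_eqOn_range_orthogonal (T : H₁ →ₗ[ℂ] H₁) (fun x => ?_) (fun y hy => ?_)
    · change c₂ (V (c₁ (T x))) = V (T x)
      rw [← hTc, hVT', hVT', hc, c₂.apply_apply]
    · rw [hV0 y hy, Conjugation.conjOp_apply, hV0' (c₁ y), map_zero]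
      intro x
      rw [c₁.inner_apply_right, ← hTc, ← inner_conj_symm]
      have : ⟪T (c₁ x), y⟫_ℂ = 0 := hy (c₁ x)
      rw [this, map_zero]

/-- Intertwining partial isometries with orthogonal ranges that fill the essential subspace. They
can be chosen within any class of operators that contains enough of them. -/
theorem IsNormal.exists_family (hΦ : IsNormal Φ) (R : (H₁ →L[ℂ] H₂) → Prop) (R0 : R 0)
    (hR : ∀ W, IsIntertwiner Φ W → W ≠ 0 → ∃ V, IsIntertwiner Φ V ∧ V ≠ 0 ∧
      (∀ ξ, V (V.adjoint (V ξ)) = V ξ) ∧ R V ∧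
      ∀ Z, R Z → (∀ ξ, Z.adjoint (W ξ) = 0) → ∀ ξ, Z.adjoint (V ξ) = 0) :
    ∃ V : H₂ → H₁ →L[ℂ] H₂, (∀ i, IsIntertwiner Φ (V i)) ∧ (∀ i, R (V i)) ∧
      (∀ i ξ, V i ((V i).adjoint (V i ξ)) = V i ξ) ∧
      (∀ i j, i ≠ j → ∀ ξ, (V i).adjoint (V j ξ) = 0) ∧
      ∀ η, (∀ i, (V i).adjoint η = 0) → (Φ 1 : H₂ →L[ℂ] H₂) η = 0 := by
  let good : (H₁ →L[ℂ] H₂) → Prop := fun V =>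
    IsIntertwiner Φ V ∧ R V ∧ ∀ ξ, V (V.adjoint (V ξ)) = V ξ
  have good0 : good 0 := ⟨fun a ξ => by simp, R0, fun ξ => by simp⟩
  obtain ⟨𝒱, h𝒱⟩ := zorn_subset
    {s : Set (H₁ →L[ℂ] H₂) | (∀ V ∈ s, good V ∧ V ≠ 0) ∧
      ∀ V ∈ s, ∀ V' ∈ s, V ≠ V' → ∀ ξ, V.adjoint (V' ξ) = 0} (by
    intro c hc hchain
    refine ⟨⋃₀ c, ⟨?_, ?_⟩, fun s hs => Set.subset_sUnion_of_mem hs⟩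
    · rintro V ⟨s, hs, hV⟩
      exact (hc hs).1 V hV
    · rintro V ⟨s, hs, hV⟩ V' ⟨s', hs', hV'⟩ hne
      obtain hss | hss := hchain.total hs hs'
      · exact (hc hs').2 V (hss hV) V' hV' hne
      · exact (hc hs).2 V hV V' (hss hV') hne)
  have htotal : ∀ η, (∀ V ∈ 𝒱, V.adjoint η = 0) → (Φ 1 : H₂ →L[ℂ] H₂) η = 0 := by
    intro η hη
    by_contra hne
    obtain ⟨W, hW, hW0, hWZ⟩ := hΦ.exists_intertwiner hne
    obtain ⟨V, hV, hV0, hVp, hVR, hVZ⟩ := hR W hW hW0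
    have horth : ∀ Z ∈ 𝒱, ∀ ξ, Z.adjoint (V ξ) = 0 := fun Z hZ =>
      hVZ Z (h𝒱.1.1 Z hZ).1.2.1 (hWZ Z (h𝒱.1.1 Z hZ).1.1 (hη Z hZ))
    have horth' : ∀ Z ∈ 𝒱, ∀ ξ, V.adjoint (Z ξ) = 0 := by
      intro Z hZ ξ
      refine ext_inner_left ℂ fun ζ => ?_
      rw [ContinuousLinearMap.adjoint_inner_right, ← ContinuousLinearMap.adjoint_inner_left,
        horth Z hZ, inner_zero_left, inner_zero_right]
    have hmem : insert V 𝒱 ∈ {s : Set (H₁ →L[ℂ] H₂) | (∀ V ∈ s, good V ∧ V ≠ 0) ∧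
        ∀ V ∈ s, ∀ V' ∈ s, V ≠ V' → ∀ ξ, V.adjoint (V' ξ) = 0} := by
      refine ⟨?_, ?_⟩
      · rintro Z (rfl | hZ)
        · exact ⟨⟨hV, hVR, hVp⟩, hV0⟩
        · exact h𝒱.1.1 Z hZ
      · rintro Z (rfl | hZ) Z' (rfl | hZ') hne
        · exact absurd rfl hne
        · exact horth' Z' hZ'
        · exact horth Z hZ
        · exact h𝒱.1.2 Z hZ Z' hZ' hne
    -- By maximality the new `V` already belongs to the family to which it is orthogonal, so `V = V
    -- V⋆ V = 0`.
    have hV𝒱 : V ∈ 𝒱 := h𝒱.2 hmem (Set.subset_insert _ _) (Set.mem_insert _ _)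
    refine hV0 ?_
    ext ξ
    rw [← hVp, horth V hV𝒱, map_zero]
    rfl
  have hpt : ∀ V : 𝒱, ∃ ξ, (V : H₁ →L[ℂ] H₂) ξ ≠ 0 := by
    intro V
    by_contra! hcon
    exact (h𝒱.1.1 V V.2).2 (ContinuousLinearMap.ext hcon)
  choose x hx using hpt
  -- Nonzero vectors in orthogonal ranges are distinct, so the family can be indexed by `H₂`, padded
  -- with zeros. Thus `ℓ²` over the index set lives in the universe of `H₂`.
  let g : 𝒱 → H₂ := fun V => (V : H₁ →L[ℂ] H₂) (x V)
  have hg : Function.Injective g := by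
    intro V V' h
    by_contra hne
    refine hx V ?_
    have h1 := h𝒱.1.2 V V.2 V' V'.2 (fun h => hne (Subtype.ext h)) (x V')
    change (V : H₁ →L[ℂ] H₂) (x V) = (V' : H₁ →L[ℂ] H₂) (x V') at h
    rw [← h] at h1
    rw [← inner_self_eq_zero (𝕜 := ℂ), ← ContinuousLinearMap.adjoint_inner_right, h1,
      inner_zero_right]
  let F : H₂ → H₁ →L[ℂ] H₂ := Function.extend g Subtype.val 0
  have hF : ∀ i, (∃ V : 𝒱, g V = i ∧ F i = V) ∨ F i = 0 := by
    intro i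
    by_cases h : ∃ V, g V = i
    · obtain ⟨V, rfl⟩ := h
      exact Or.inl ⟨V, rfl, hg.extend_apply _ _ V⟩
    · exact Or.inr (Function.extend_apply' _ _ _ h)
  have hFgood : ∀ i, good (F i) := by
    intro i
    obtain ⟨V, -, h⟩ | h := hF i
    · rw [h]; exact (h𝒱.1.1 V V.2).1
    · rw [h]; exact good0
  refine ⟨F, fun i => (hFgood i).1, fun i => (hFgood i).2.1, fun i => (hFgood i).2.2, ?_, ?_⟩
  · intro i j hij ξ
    obtain ⟨V, hV, h⟩ | h := hF i
    · obtain ⟨V', hV', h'⟩ | h' := hF j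
      · rw [h, h']
        refine h𝒱.1.2 V V.2 V' V'.2 (fun hVV => hij ?_) ξ
        rw [← hV, ← hV', Subtype.ext hVV]
      · rw [h']; simp
    · rw [h]; simp
  · intro η hη
    refine htotal η fun V hV => ?_
    have := hη (g ⟨V, hV⟩)
    rwa [show F (g ⟨V, hV⟩) = V from hg.extend_apply _ _ _] at this

end Polar


/-! ### Operators on `H ⊗ L` from their components, and the space `ℓ²`. -/

section Assemble

variable {H : Type u} {L : Type v} [NormedAddCommGroup H] [InnerProductSpace ℂ H]
  [NormedAddCommGroup L] [InnerProductSpace ℂ L] {K : Type*} [NormedAddCommGroup K]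
  [InnerProductSpace ℂ K]

theorem norm_sum_sq_of_orthogonal {ι : Type*} (s : Finset ι) (w : ι → K)
    (h : ∀ i j, i ≠ j → ⟪w i, w j⟫_ℂ = 0) : ‖∑ i ∈ s, w i‖ ^ 2 = ∑ i ∈ s, ‖w i‖ ^ 2 := by
  classical
  induction s using Finset.induction_on with
  | empty => simp
  | insert i s hi ih =>
    rw [Finset.sum_insert hi, Finset.sum_insert hi, @norm_add_sq ℂ, ih, inner_sum,
      Finset.sum_eq_zero fun j hj => h i j (ne_of_mem_of_not_mem hj hi).symm]
    simp

/-- `V⋆` preserves norms on the range of `V`, so Cauchy–Schwarz for `‖V ξ‖² = ⟪ξ, V⋆ V ξ⟫` suffices.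
-/
theorem norm_apply_le_of_partialIsometry [CompleteSpace H] [CompleteSpace K] {V : H →L[ℂ] K}
    (hV : ∀ ξ, V (V.adjoint (V ξ)) = V ξ) (ξ : H) : ‖V ξ‖ ≤ ‖ξ‖ := by
  have h1 : ‖V.adjoint (V ξ)‖ = ‖V ξ‖ := by
    rw [@norm_eq_sqrt_re_inner ℂ, @norm_eq_sqrt_re_inner ℂ,
      ContinuousLinearMap.adjoint_inner_right, hV]
  have h2 : ‖V ξ‖ ^ 2 ≤ ‖ξ‖ * ‖V ξ‖ := by
    rw [← inner_self_eq_norm_sq (𝕜 := ℂ), ← ContinuousLinearMap.adjoint_inner_right]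
    exact (re_inner_le_norm _ _).trans (by rw [h1])
  rcases (norm_nonneg (V ξ)).eq_or_lt with h0 | h0
  · rw [← h0]; exact norm_nonneg _
  · rw [sq] at h2
    exact le_of_mul_le_mul_right h2 h0

/-- Contractions with orthogonal ranges are the components of an operator on `H ⊗ L`. -/
theorem exists_operator_of_family [CompleteSpace H] [CompleteSpace K] {ι : Type*} {e : ι → L}
    (he : Orthonormal ℂ e) (V : ι → H →L[ℂ] K) (hV : ∀ i ξ, ‖V i ξ‖ ≤ ‖ξ‖)
    (horth : ∀ i j, i ≠ j → ∀ ξ, (V i).adjoint (V j ξ) = 0) :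
    ∃ u : HilbertTensor H L →L[ℂ] K, ∀ i ξ, u (tmulHat ξ (e i)) = V i ξ := by
  classical
  let A : (ι →₀ H) →ₗ[ℂ] HilbertTensor H L :=
    Finsupp.lsum ℂ fun i => ((tmulRight (e i) : H →L[ℂ] HilbertTensor H L) : H →ₗ[ℂ] HilbertTensor H L)
  let B : (ι →₀ H) →ₗ[ℂ] K := Finsupp.lsum ℂ fun i => (V i : H →ₗ[ℂ] K)
  -- Both norms are computed by Pythagoras and compared term by term.
  have hAB : ∀ f, ‖B f‖ ≤ ‖A f‖ := by
    intro f
    have h1 : ‖A f‖ ^ 2 = ∑ i ∈ f.support, ‖tmulHat (f i) (e i)‖ ^ 2 := by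
      refine norm_sum_sq_of_orthogonal f.support (fun i => tmulHat (f i) (e i)) fun i j hij => ?_
      rw [inner_tmulHat, he.2 hij, mul_zero]
    have h2 : ‖B f‖ ^ 2 = ∑ i ∈ f.support, ‖V i (f i)‖ ^ 2 := by
      refine norm_sum_sq_of_orthogonal f.support (fun i => V i (f i)) fun i j hij => ?_
      rw [← ContinuousLinearMap.adjoint_inner_right, horth i j hij, inner_zero_right]
    refine le_of_sq_le_sq ?_ (norm_nonneg _)
    rw [h1, h2]
    refine Finset.sum_le_sum fun i _ => ?_
    rw [norm_tmulHat, he.1 i, mul_one]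
    gcongr
    exact hV i _
  obtain ⟨u, hu, -⟩ := exists_factor_of_norm_le A B hAB
  refine ⟨u, fun i ξ => ?_⟩
  have h1 : A (Finsupp.single i ξ) = tmulHat ξ (e i) := by
    simp only [A, Finsupp.lsum_single]
    rfl
  have h2 : B (Finsupp.single i ξ) = V i ξ := by
    simp only [B, Finsupp.lsum_single]
    rfl
  rw [← h1, hu, h2]

theorem lp_clm_ext {ι : Type*} [DecidableEq ι] {F : Type*} [NormedAddCommGroup F]
    [NormedSpace ℂ F] {S T : lp (fun _ : ι => ℂ) 2 →L[ℂ] F}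
    (h : ∀ i, S (lp.single 2 i 1) = T (lp.single 2 i 1)) : S = T := by
  ext f
  have h1 := lp.hasSum_single (p := 2) (by norm_num) f
  refine (h1.mapL S).unique ?_
  convert h1.mapL T using 2 with i
  have h2 : lp.single 2 i (f i) = f i • lp.single (E := fun _ : ι => ℂ) 2 i (1 : ℂ) := by
    rw [← lp.single_smul, smul_eq_mul, mul_one]
  rw [h2, map_smul, map_smul, h]

theorem hilbertTensor_lp_ext {ι : Type v} [DecidableEq ι] {F : Type*} [NormedAddCommGroup F]
    [NormedSpace ℂ F] {S T : HilbertTensor H (lp (fun _ : ι => ℂ) 2) →L[ℂ] F}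
    (h : ∀ ξ i, S (tmulHat ξ (lp.single 2 i 1)) = T (tmulHat ξ (lp.single 2 i 1))) : S = T := by
  refine hilbertTensor_ext fun ξ ζ => ?_
  have : S.comp (tmulLeft ξ) = T.comp (tmulLeft ξ) := lp_clm_ext fun i => h ξ i
  exact DFunLike.congr_fun this ζ

/-- The coordinatewise conjugation of `ℓ²(ι)`. -/
noncomputable def lpConjugation (ι : Type*) : Conjugation (lp (fun _ : ι => ℂ) 2) where
  toLinearIsometry := (starₗᵢ ℂ : lp (fun _ : ι => ℂ) 2 ≃ₗᵢ⋆[ℂ] _).toLinearIsometry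
  involutive' ξ := star_star ξ

theorem lpConjugation_single {ι : Type*} [DecidableEq ι] (i : ι) :
    lpConjugation ι (lp.single 2 i 1) = lp.single 2 i 1 := by
  change star (lp.single (E := fun _ : ι => ℂ) 2 i (1 : ℂ)) = _
  ext j
  rw [lp.star_apply, lp.single_apply]
  by_cases h : j = i
  · subst h; simp
  · simp [h]

theorem orthonormal_lp_single (ι : Type*) [DecidableEq ι] :
    Orthonormal ℂ fun i : ι => lp.single (E := fun _ : ι => ℂ) 2 i (1 : ℂ) := by
  rw [orthonormal_iff_ite]
  intro i j
  rw [lp.inner_single_left, lp.single_apply]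
  by_cases h : i = j
  · subst h; simp
  · simp [h]

end Assemble

/-! ### The operator `u` implementing `Φ`. -/

section Implementation

variable {H₁ : Type u} [NormedAddCommGroup H₁] [InnerProductSpace ℂ H₁] [CompleteSpace H₁]
  {H₂ : Type v} [NormedAddCommGroup H₂] [InnerProductSpace ℂ H₂] [CompleteSpace H₂]
  {M₁ : VonNeumannAlgebra H₁} {M₂ : VonNeumannAlgebra H₂}
  {Φ : M₁.toStarSubalgebra →⋆ₙₐ[ℂ] M₂.toStarSubalgebra}

theorem map_mul_apply (a b : M₁.toStarSubalgebra) (η : H₂) :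
    (Φ (a * b) : H₂ →L[ℂ] H₂) η = (Φ a : H₂ →L[ℂ] H₂) ((Φ b : H₂ →L[ℂ] H₂) η) := by
  rw [map_mul]
  rfl

/-- A family as in `IsNormal.exists_family` defines a coisometry from `H₁ ⊗ ℓ²` onto the essential
subspace of `Φ` which intertwines the amplification with `Φ`. -/
theorem exists_implementing_operator [DecidableEq H₂] (V : H₂ → H₁ →L[ℂ] H₂)
    (hV : ∀ i, IsIntertwiner Φ (V i)) (hp : ∀ i ξ, V i ((V i).adjoint (V i ξ)) = V i ξ)
    (horth : ∀ i j, i ≠ j → ∀ ξ, (V i).adjoint (V j ξ) = 0)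
    (htotal : ∀ η, (∀ i, (V i).adjoint η = 0) → (Φ 1 : H₂ →L[ℂ] H₂) η = 0) :
    ∃ u : HilbertTensor H₁ (lp (fun _ : H₂ => ℂ) 2) →L[ℂ] H₂,
      (∀ i ξ, u (tmulHat ξ (lp.single 2 i 1)) = V i ξ) ∧
      (∀ (a : M₁.toStarSubalgebra) t, u (tensorOp (a : H₁ →L[ℂ] H₁) 1 t) =
        (Φ a : H₂ →L[ℂ] H₂) (u t)) ∧
      u.comp u.adjoint = (Φ 1 : H₂ →L[ℂ] H₂) := by
  obtain ⟨u, hu⟩ := exists_operator_of_family (orthonormal_lp_single H₂) V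
    (fun i ξ => norm_apply_le_of_partialIsometry (hp i) ξ) horth
  have hint : ∀ (a : M₁.toStarSubalgebra) t, u (tensorOp (a : H₁ →L[ℂ] H₁) 1 t) =
      (Φ a : H₂ →L[ℂ] H₂) (u t) := by
    intro a t
    have : u.comp (tensorOp (a : H₁ →L[ℂ] H₁) 1) = (Φ a : H₂ →L[ℂ] H₂).comp u := by
      refine hilbertTensor_lp_ext fun ξ i => ?_
      rw [ContinuousLinearMap.comp_apply, ContinuousLinearMap.comp_apply, tensorOp_tmulHat, hu]
      change u (tmulHat ((a : H₁ →L[ℂ] H₁) ξ) (lp.single 2 i 1)) = _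
      rw [hu, hV]
    exact DFunLike.congr_fun this t
  refine ⟨u, hu, hint, ?_⟩
  have hadj : ∀ i ξ, u.adjoint (V i ξ) =
      tmulHat ((V i).adjoint (V i ξ)) (lp.single 2 i 1) := by
    intro i ξ
    have : innerSL ℂ (u.adjoint (V i ξ)) =
        innerSL ℂ (tmulHat ((V i).adjoint (V i ξ)) (lp.single 2 i 1)) := by
      refine hilbertTensor_lp_ext fun ζ j => ?_
      rw [innerSL_apply_apply, innerSL_apply_apply, ContinuousLinearMap.adjoint_inner_left, hu,
        inner_tmulHat, lp.inner_single_left, lp.single_apply]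
      by_cases h : i = j
      · subst h
        rw [ContinuousLinearMap.adjoint_inner_left]
        simp
      · rw [← ContinuousLinearMap.adjoint_inner_left, horth j i (Ne.symm h)]
        simp [h]
    exact ext_inner_right ℂ fun z => DFunLike.congr_fun this z
  have hfix : ∀ i ξ, u (u.adjoint (V i ξ)) = V i ξ := fun i ξ => by rw [hadj, hu, hp]
  have hone : ∀ t, (Φ 1 : H₂ →L[ℂ] H₂) (u t) = u t := by
    intro t
    have h1 := hint 1 t
    change u (tensorOp 1 1 t) = _ at h1
    rw [tensorOp_one] at h1
    exact h1.symm
  have hidem : ∀ η, (Φ 1 : H₂ →L[ℂ] H₂) ((Φ 1 : H₂ →L[ℂ] H₂) η) = (Φ 1 : H₂ →L[ℂ] H₂) η := by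
    intro η
    rw [← map_mul_apply, one_mul]
  ext η
  -- Since `u u⋆` fixes the range of each `V i`, this vector is orthogonal to all of them, hence
  -- killed by `Φ(1)`. It also lies in the range of `Φ(1)`, so it is zero.
  have h1 : ∀ i, (V i).adjoint ((Φ 1 : H₂ →L[ℂ] H₂) η - u (u.adjoint η)) = 0 := by
    intro i
    rw [map_sub, (hV i).adjoint_apply]
    change (V i).adjoint η - _ = 0
    rw [sub_eq_zero]
    refine ext_inner_right ℂ fun ξ => ?_
    have h3 : ⟪u (u.adjoint η), V i ξ⟫_ℂ = ⟪η, V i ξ⟫_ℂ := by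
      rw [← ContinuousLinearMap.adjoint_inner_right, ContinuousLinearMap.adjoint_inner_left, hfix]
    rw [ContinuousLinearMap.adjoint_inner_left, ContinuousLinearMap.adjoint_inner_left, h3]
  have h2 := htotal _ h1
  rw [map_sub, hidem, hone, sub_eq_zero] at h2
  exact h2.symm

end Implementation

/-! ### The factorization obtained from `u`. -/

section Build

variable {H₁ : Type u} [NormedAddCommGroup H₁] [InnerProductSpace ℂ H₁] [CompleteSpace H₁]
  {L : Type v} [NormedAddCommGroup L] [InnerProductSpace ℂ L]
  {H₂ : Type v} [NormedAddCommGroup H₂] [InnerProductSpace ℂ H₂] [CompleteSpace H₂]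
  {M₁ : VonNeumannAlgebra H₁} {M₂ : VonNeumannAlgebra H₂}
  {Φ : M₁.toStarSubalgebra →⋆ₙₐ[ℂ] M₂.toStarSubalgebra}

variable {u : HilbertTensor H₁ L →L[ℂ] H₂}

theorem map_one_apply_of_intertwines
    (hu : ∀ (a : M₁.toStarSubalgebra) t, u (tensorOp (a : H₁ →L[ℂ] H₁) 1 t) =
      (Φ a : H₂ →L[ℂ] H₂) (u t)) (t : HilbertTensor H₁ L) :
    (Φ 1 : H₂ →L[ℂ] H₂) (u t) = u t := by
  have h1 := hu 1 t
  change u (tensorOp 1 1 t) = _ at h1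
  rw [tensorOp_one] at h1
  exact h1.symm

/-- `Φ(1)` fixes the range of `u` because `1 ⊗ 1 = 1`, so `u⋆ (u u⋆) u = u⋆ Φ(1) u = u⋆ u`. -/
theorem isStarProjection_adjoint_comp_self
    (hu : ∀ (a : M₁.toStarSubalgebra) t, u (tensorOp (a : H₁ →L[ℂ] H₁) 1 t) =
      (Φ a : H₂ →L[ℂ] H₂) (u t)) (huu : u.comp u.adjoint = (Φ 1 : H₂ →L[ℂ] H₂)) :
    IsStarProjection (u.adjoint.comp u) := by
  refine ⟨?_, ?_⟩
  · ext t
    change u.adjoint ((u.comp u.adjoint) (u t)) = u.adjoint (u t)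
    rw [huu, map_one_apply_of_intertwines hu]
  · exact ((ContinuousLinearMap.isPositive_adjoint_comp_self u)).isSelfAdjoint

theorem conj_reduced_eq
    (hu : ∀ (a : M₁.toStarSubalgebra) t, u (tensorOp (a : H₁ →L[ℂ] H₁) 1 t) =
      (Φ a : H₂ →L[ℂ] H₂) (u t)) (huu : u.comp u.adjoint = (Φ 1 : H₂ →L[ℂ] H₂))
    (a : M₁.toStarSubalgebra) :
    (u.comp (tensorOp (a : H₁ →L[ℂ] H₁) 1 * (u.adjoint.comp u))).comp u.adjoint =
      (Φ a : H₂ →L[ℂ] H₂) := by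
  ext η
  change u (tensorOp (a : H₁ →L[ℂ] H₁) 1 (u.adjoint ((u.comp u.adjoint) η))) = _
  rw [hu]
  change (Φ a : H₂ →L[ℂ] H₂) ((u.comp u.adjoint) ((u.comp u.adjoint) η)) = _
  rw [huu, ← map_mul_apply, ← map_mul_apply, mul_one, mul_one]

variable [CompleteSpace L]

variable (L M₁) in
/-- The amplification `a ↦ a ⊗ 1`. -/
noncomputable def amplify : M₁.toStarSubalgebra →⋆ₐ[ℂ] (amplification L M₁).toStarSubalgebra where
  toFun a := ⟨tensorOp (a : H₁ →L[ℂ] H₁) 1, tensorOp_mem_amplification a⟩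
  map_one' := Subtype.ext tensorOp_one
  map_mul' a b := Subtype.ext (tensorOp_mul_one (a : H₁ →L[ℂ] H₁) (b : H₁ →L[ℂ] H₁))
  map_zero' := Subtype.ext (tensorOp_zero_left _)
  map_add' a b := Subtype.ext (tensorOp_add_left (a : H₁ →L[ℂ] H₁) (b : H₁ →L[ℂ] H₁) _)
  commutes' r := Subtype.ext (tensorOp_algebraMap r)
  map_star' a := Subtype.ext (tensorOp_star_one (a : H₁ →L[ℂ] H₁))

theorem amplify_bijective [Nontrivial L] : Function.Bijective (amplify L M₁) := by
  refine ⟨fun a b h => Subtype.ext (tensorOp_one_injective (congrArg Subtype.val h)), fun t => ?_⟩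
  obtain ⟨a, ha⟩ := exists_eq_tensorOp t.2
  exact ⟨a, Subtype.ext ha.symm⟩

/-- Transport of an involutive antiautomorphism along an isomorphism. -/
def InvolutiveStarAntiAut.transport {A B : Type*} [Ring A] [Algebra ℂ A] [StarRing A]
    [Ring B] [Algebra ℂ B] [StarRing B] (α : InvolutiveStarAntiAut A) (e : A ≃⋆ₐ[ℂ] B) :
    InvolutiveStarAntiAut B where
  toFun x := e (α (e.symm x))
  map_add' x y := by simp
  map_smul' r x := by simp
  map_star' x := by
    have := α.map_star' (e.symm x)
    rw [map_star, ← map_star e]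
    exact congrArg e this
  map_mul_rev' x y := by
    have := α.map_mul_rev' (e.symm x) (e.symm y)
    rw [map_mul, ← map_mul e]
    exact congrArg e this
  involutive' x := by
    have := α.involutive' (e.symm x)
    rw [e.symm_apply_apply]
    exact (congrArg e this).trans (e.apply_symm_apply x)

/-- The antiautomorphism induced on the domain of an injective `*`-homomorphism whose range is
invariant. -/
def InvolutiveStarAntiAut.pullback {A B : Type*} [NonUnitalRing A] [Module ℂ A]
    [StarRing A] [NonUnitalRing B] [Module ℂ B] [StarRing B] (α : InvolutiveStarAntiAut B)
    (f : A →⋆ₙₐ[ℂ] B) (hf : Function.Injective f) (g : A → A) (hg : ∀ x, f (g x) = α (f x)) :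
    InvolutiveStarAntiAut A where
  toFun := g
  map_add' x y := hf <| by rw [map_add, hg, hg, hg, map_add, map_add]
  map_smul' r x := hf <| by
    rw [map_smul, hg, hg, map_smul, map_smul]
    rfl
  map_star' x := hf <| by
    rw [map_star, hg, hg, map_star]
    exact α.map_star' _
  map_mul_rev' x y := hf <| by
    rw [map_mul, hg, hg, hg, map_mul]
    exact α.map_mul_rev' _ _
  involutive' x := hf <| by
    rw [hg, hg]
    exact α.involutive' _

/-- The reduction `x ↦ x p`. -/
noncomputable def reduce {H : Type*} [NormedAddCommGroup H] [InnerProductSpace ℂ H]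
    [CompleteSpace H] (N : VonNeumannAlgebra H) (p : H →L[ℂ] H) (hp : IsStarProjection p)
    (hpN : p ∈ N.commutant) : N.toStarSubalgebra →⋆ₙₐ[ℂ] reducedAlgebra N p hp hpN where
  toFun x := ⟨x * p, x, x.2, rfl⟩
  map_smul' r x := Subtype.ext (smul_mul_assoc r (x : H →L[ℂ] H) p)
  map_zero' := Subtype.ext (zero_mul p)
  map_add' x y := Subtype.ext (add_mul (x : H →L[ℂ] H) y p)
  map_mul' x y := Subtype.ext <| by
    change (x : H →L[ℂ] H) * y * p = x * p * (y * p)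
    have h : (y : H →L[ℂ] H) * p = p * y := VonNeumannAlgebra.mem_commutant_iff.1 hpN y y.2
    have hpp : p * p = p := hp.isIdempotentElem
    rw [h, mul_assoc, h, mul_assoc, ← mul_assoc p p, hpp]
  map_star' x := Subtype.ext <| by
    change star (x : H →L[ℂ] H) * p = star ((x : H →L[ℂ] H) * p)
    have h : star (x : H →L[ℂ] H) * p = p * star (x : H →L[ℂ] H) :=
      VonNeumannAlgebra.mem_commutant_iff.1 hpN _ (star x).2
    rw [star_mul, hp.isSelfAdjoint.star_eq, h]

theorem adjoint_intertwines
    (hu : ∀ (a : M₁.toStarSubalgebra) t, u (tensorOp (a : H₁ →L[ℂ] H₁) 1 t) =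
      (Φ a : H₂ →L[ℂ] H₂) (u t)) (a : M₁.toStarSubalgebra) (η : H₂) :
    u.adjoint ((Φ a : H₂ →L[ℂ] H₂) η) = tensorOp (a : H₁ →L[ℂ] H₁) 1 (u.adjoint η) := by
  refine ext_inner_left ℂ fun t => ?_
  rw [ContinuousLinearMap.adjoint_inner_right, ← ContinuousLinearMap.adjoint_inner_left,
    ← ContinuousLinearMap.adjoint_inner_left, ContinuousLinearMap.adjoint_inner_right]
  have h1 : (Φ a : H₂ →L[ℂ] H₂).adjoint = (Φ (star a) : H₂ →L[ℂ] H₂) := by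
    rw [map_star]; rfl
  have h2 : (tensorOp (a : H₁ →L[ℂ] H₁) (1 : L →L[ℂ] L)).adjoint =
      tensorOp ((star a : M₁.toStarSubalgebra) : H₁ →L[ℂ] H₁) 1 := by
    rw [← ContinuousLinearMap.star_eq_adjoint, star_tensorOp, star_one]
    rfl
  rw [h1, h2, hu]

theorem adjoint_comp_self_mem_commutant
    (hu : ∀ (a : M₁.toStarSubalgebra) t, u (tensorOp (a : H₁ →L[ℂ] H₁) 1 t) =
      (Φ a : H₂ →L[ℂ] H₂) (u t)) : u.adjoint.comp u ∈ (amplification L M₁).commutant := by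
  rw [mem_commutant_amplification_iff]
  intro a
  ext t
  change tensorOp (a : H₁ →L[ℂ] H₁) 1 (u.adjoint (u t)) =
    u.adjoint (u (tensorOp (a : H₁ →L[ℂ] H₁) 1 t))
  rw [hu, adjoint_intertwines hu]

/-- The spatial isomorphism `y ↦ u y u⋆` of the reduced algebra. -/
noncomputable def spatial [Nontrivial L]
    (hu : ∀ (a : M₁.toStarSubalgebra) t, u (tensorOp (a : H₁ →L[ℂ] H₁) 1 t) =
      (Φ a : H₂ →L[ℂ] H₂) (u t)) (huu : u.comp u.adjoint = (Φ 1 : H₂ →L[ℂ] H₂)) :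
    reducedAlgebra (amplification L M₁) (u.adjoint.comp u)
      (isStarProjection_adjoint_comp_self hu huu) (adjoint_comp_self_mem_commutant hu) →⋆ₙₐ[ℂ]
    M₂.toStarSubalgebra where
  toFun y := ⟨(u.comp (y : HilbertTensor H₁ L →L[ℂ] HilbertTensor H₁ L)).comp u.adjoint, by
    obtain ⟨_, x, hx, rfl⟩ := y
    obtain ⟨a, rfl⟩ := exists_eq_tensorOp hx
    change (u.comp (tensorOp (a : H₁ →L[ℂ] H₁) 1 * (u.adjoint.comp u))).comp u.adjoint ∈ _
    rw [conj_reduced_eq hu huu]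
    exact (Φ a).2⟩
  map_smul' r y := Subtype.ext <| by ext η; exact map_smul u r _
  map_zero' := Subtype.ext <| by ext η; exact map_zero u
  map_add' y z := Subtype.ext <| by ext η; exact map_add u _ _
  map_mul' y z := Subtype.ext <| by
    have hz : ∀ t, (u.adjoint.comp u) ((z : HilbertTensor H₁ L →L[ℂ] HilbertTensor H₁ L) t) =
        (z : HilbertTensor H₁ L →L[ℂ] HilbertTensor H₁ L) t := by
      obtain ⟨_, x, hx, rfl⟩ := z
      intro t
      have h1 : x * (u.adjoint.comp u) = (u.adjoint.comp u) * x :=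
        VonNeumannAlgebra.mem_commutant_iff.1 (adjoint_comp_self_mem_commutant hu) x hx
      have h2 : (u.adjoint.comp u) * (u.adjoint.comp u) = u.adjoint.comp u :=
        (isStarProjection_adjoint_comp_self hu huu).isIdempotentElem
      change ((u.adjoint.comp u) * (x * (u.adjoint.comp u))) t = (x * (u.adjoint.comp u)) t
      rw [h1, ← mul_assoc, h2]
    ext η
    change u ((y : HilbertTensor H₁ L →L[ℂ] HilbertTensor H₁ L)
        ((z : HilbertTensor H₁ L →L[ℂ] HilbertTensor H₁ L) (u.adjoint η))) =
      u ((y : HilbertTensor H₁ L →L[ℂ] HilbertTensor H₁ L) ((u.adjoint.comp u)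
        ((z : HilbertTensor H₁ L →L[ℂ] HilbertTensor H₁ L) (u.adjoint η))))
    rw [hz]
  map_star' y := Subtype.ext <| by
    change (u.comp (ContinuousLinearMap.adjoint
        (y : HilbertTensor H₁ L →L[ℂ] HilbertTensor H₁ L))).comp u.adjoint =
      ContinuousLinearMap.adjoint
        ((u.comp (y : HilbertTensor H₁ L →L[ℂ] HilbertTensor H₁ L)).comp u.adjoint)
    rw [ContinuousLinearMap.adjoint_comp, ContinuousLinearMap.adjoint_comp,
      ContinuousLinearMap.adjoint_adjoint, ContinuousLinearMap.comp_assoc]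

theorem spatial_reduce_amplify [Nontrivial L]
    (hu : ∀ (a : M₁.toStarSubalgebra) t, u (tensorOp (a : H₁ →L[ℂ] H₁) 1 t) =
      (Φ a : H₂ →L[ℂ] H₂) (u t)) (huu : u.comp u.adjoint = (Φ 1 : H₂ →L[ℂ] H₂))
    (a : M₁.toStarSubalgebra) :
    spatial hu huu (reduce _ _ _ _ (amplify L M₁ a)) = Φ a :=
  Subtype.ext (conj_reduced_eq hu huu a)

theorem reduce_amplify_surjective [Nontrivial L] {p : HilbertTensor H₁ L →L[ℂ] HilbertTensor H₁ L}
    {hp : IsStarProjection p} {hpN : p ∈ (amplification L M₁).commutant}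
    (y : reducedAlgebra (amplification L M₁) p hp hpN) :
    ∃ a, reduce _ p hp hpN (amplify L M₁ a) = y := by
  obtain ⟨_, x, hx, rfl⟩ := y
  obtain ⟨a, rfl⟩ := exists_eq_tensorOp hx
  exact ⟨a, rfl⟩

/-- The image of `(a ⊗ 1) u⋆ u` is `Φ(a)`, and `(a ⊗ 1) u⋆ u = u⋆ Φ(a) u` vanishes with it. -/
theorem spatial_injective [Nontrivial L]
    (hu : ∀ (a : M₁.toStarSubalgebra) t, u (tensorOp (a : H₁ →L[ℂ] H₁) 1 t) =
      (Φ a : H₂ →L[ℂ] H₂) (u t)) (huu : u.comp u.adjoint = (Φ 1 : H₂ →L[ℂ] H₂)) :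
    Function.Injective (spatial hu huu) := by
  rw [injective_iff_map_eq_zero]
  intro y hy
  obtain ⟨a, rfl⟩ := reduce_amplify_surjective y
  rw [spatial_reduce_amplify] at hy
  refine Subtype.ext ?_
  ext t
  change tensorOp (a : H₁ →L[ℂ] H₁) 1 (u.adjoint (u t)) = 0
  rw [← adjoint_intertwines hu, hy]
  exact map_zero u.adjoint

/-- The image of `Φ` is `α₂`-stable because `Φ` intertwines the antiautomorphisms. Pulling `α₂` back
then makes `x p ↦ (α₁ ⊗ id)(x) p` well defined. -/
theorem exists_spatial_eq [Nontrivial L] {α₁ : InvolutiveStarAntiAut M₁.toStarSubalgebra}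
    {α₂ : InvolutiveStarAntiAut M₂.toStarSubalgebra} (hα : ∀ a, Φ (α₁ a) = α₂ (Φ a))
    (hu : ∀ (a : M₁.toStarSubalgebra) t, u (tensorOp (a : H₁ →L[ℂ] H₁) 1 t) =
      (Φ a : H₂ →L[ℂ] H₂) (u t)) (huu : u.comp u.adjoint = (Φ 1 : H₂ →L[ℂ] H₂))
    (y : reducedAlgebra (amplification L M₁) (u.adjoint.comp u)
      (isStarProjection_adjoint_comp_self hu huu) (adjoint_comp_self_mem_commutant hu)) :
    ∃ z, spatial hu huu z = α₂ (spatial hu huu y) := by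
  obtain ⟨a, rfl⟩ := reduce_amplify_surjective y
  exact ⟨reduce _ _ _ _ (amplify L M₁ (α₁ a)), by
    rw [spatial_reduce_amplify, spatial_reduce_amplify, hα]⟩

variable (L M₁) in
/-- The isomorphism of `M` onto its amplification. -/
noncomputable def amplifyEquiv [Nontrivial L] :
    M₁.toStarSubalgebra ≃⋆ₐ[ℂ] (amplification L M₁).toStarSubalgebra :=
  StarAlgEquiv.ofBijective (amplify L M₁) amplify_bijective

theorem transport_amplify [Nontrivial L] (α : InvolutiveStarAntiAut M₁.toStarSubalgebra)
    (a : M₁.toStarSubalgebra) :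
    α.transport (amplifyEquiv L M₁) (amplify L M₁ a) = amplify L M₁ (α a) := by
  have h : (amplifyEquiv L M₁).symm (amplify L M₁ a) = a := (amplifyEquiv L M₁).symm_apply_apply a
  change amplify L M₁ (α ((amplifyEquiv L M₁).symm (amplify L M₁ a))) = _
  rw [h]

theorem range_spatial [Nontrivial L]
    (hu : ∀ (a : M₁.toStarSubalgebra) t, u (tensorOp (a : H₁ →L[ℂ] H₁) 1 t) =
      (Φ a : H₂ →L[ℂ] H₂) (u t)) (huu : u.comp u.adjoint = (Φ 1 : H₂ →L[ℂ] H₂)) :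
    Set.range (spatial hu huu) = Set.range Φ := by
  ext z
  constructor
  · rintro ⟨y, rfl⟩
    obtain ⟨a, rfl⟩ := reduce_amplify_surjective y
    exact ⟨a, (spatial_reduce_amplify hu huu a).symm⟩
  · rintro ⟨a, rfl⟩
    exact ⟨_, spatial_reduce_amplify hu huu a⟩

/-- The antiautomorphism of the reduced algebra that corresponds to `α₂`. -/
noncomputable def reducedAntiAut [Nontrivial L] {α₁ : InvolutiveStarAntiAut M₁.toStarSubalgebra}
    {α₂ : InvolutiveStarAntiAut M₂.toStarSubalgebra} (hα : ∀ a, Φ (α₁ a) = α₂ (Φ a))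
    (hu : ∀ (a : M₁.toStarSubalgebra) t, u (tensorOp (a : H₁ →L[ℂ] H₁) 1 t) =
      (Φ a : H₂ →L[ℂ] H₂) (u t)) (huu : u.comp u.adjoint = (Φ 1 : H₂ →L[ℂ] H₂)) :
    InvolutiveStarAntiAut (reducedAlgebra (amplification L M₁) (u.adjoint.comp u)
      (isStarProjection_adjoint_comp_self hu huu) (adjoint_comp_self_mem_commutant hu)) :=
  α₂.pullback (spatial hu huu) (spatial_injective hu huu)
    (fun y => (exists_spatial_eq hα hu huu y).choose)
    fun y => (exists_spatial_eq hα hu huu y).choose_spec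

theorem spatial_reducedAntiAut [Nontrivial L] {α₁ : InvolutiveStarAntiAut M₁.toStarSubalgebra}
    {α₂ : InvolutiveStarAntiAut M₂.toStarSubalgebra} (hα : ∀ a, Φ (α₁ a) = α₂ (Φ a))
    (hu : ∀ (a : M₁.toStarSubalgebra) t, u (tensorOp (a : H₁ →L[ℂ] H₁) 1 t) =
      (Φ a : H₂ →L[ℂ] H₂) (u t)) (huu : u.comp u.adjoint = (Φ 1 : H₂ →L[ℂ] H₂))
    (y : reducedAlgebra (amplification L M₁) (u.adjoint.comp u)
      (isStarProjection_adjoint_comp_self hu huu) (adjoint_comp_self_mem_commutant hu)) :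
    spatial hu huu (reducedAntiAut hα hu huu y) = α₂ (spatial hu huu y) :=
  (exists_spatial_eq hα hu huu y).choose_spec

theorem reducedAntiAut_reduce_amplify [Nontrivial L]
    {α₁ : InvolutiveStarAntiAut M₁.toStarSubalgebra}
    {α₂ : InvolutiveStarAntiAut M₂.toStarSubalgebra} (hα : ∀ a, Φ (α₁ a) = α₂ (Φ a))
    (hu : ∀ (a : M₁.toStarSubalgebra) t, u (tensorOp (a : H₁ →L[ℂ] H₁) 1 t) =
      (Φ a : H₂ →L[ℂ] H₂) (u t)) (huu : u.comp u.adjoint = (Φ 1 : H₂ →L[ℂ] H₂))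
    (a : M₁.toStarSubalgebra) :
    reducedAntiAut hα hu huu (reduce _ _ _ _ (amplify L M₁ a)) =
      reduce _ _ _ _ (amplify L M₁ (α₁ a)) := by
  refine spatial_injective hu huu ?_
  rw [spatial_reducedAntiAut, spatial_reduce_amplify, spatial_reduce_amplify, hα]

/-- The factorization determined by an operator that intertwines the amplification with `Φ`. -/
noncomputable def Factorization.ofOperator [Nontrivial L]
    (α₁ : InvolutiveStarAntiAut M₁.toStarSubalgebra)
    (α₂ : InvolutiveStarAntiAut M₂.toStarSubalgebra) (hα : ∀ a, Φ (α₁ a) = α₂ (Φ a))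
    (hu : ∀ (a : M₁.toStarSubalgebra) t, u (tensorOp (a : H₁ →L[ℂ] H₁) 1 t) =
      (Φ a : H₂ →L[ℂ] H₂) (u t)) (huu : u.comp u.adjoint = (Φ 1 : H₂ →L[ℂ] H₂)) :
    Factorization α₁ α₂ Φ L where
  Φ₁ := amplify L M₁
  Φ₁_apply _ := rfl
  Φ₁_surjective := amplify_bijective.2
  αt := α₁.transport (amplifyEquiv L M₁)
  αt_apply a x hx := by
    have h : x = amplify L M₁ a := Subtype.ext hx
    rw [h, transport_amplify]
    rfl
  Φ₁_intertwines a := (transport_amplify α₁ a).symm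
  p := u.adjoint.comp u
  isStarProjection_p := isStarProjection_adjoint_comp_self hu huu
  p_mem := adjoint_comp_self_mem_commutant hu
  Φ₂ := reduce _ _ _ _
  Φ₂_apply _ := rfl
  Φ₂_surjective := fun y => by
    obtain ⟨a, ha⟩ := reduce_amplify_surjective y
    exact ⟨_, ha⟩
  αb := reducedAntiAut hα hu huu
  αb_apply x y hy := by
    obtain ⟨a, rfl⟩ := amplify_bijective.2 x
    have hy' : y = reduce _ _ _ _ (amplify L M₁ a) := Subtype.ext hy
    rw [transport_amplify, hy', reducedAntiAut_reduce_amplify]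
    rfl
  Φ₂_intertwines x := by
    obtain ⟨a, rfl⟩ := amplify_bijective.2 x
    rw [transport_amplify]
    exact (reducedAntiAut_reduce_amplify hα hu huu a).symm
  Φ₃ := spatial hu huu
  Φ₃_injective := spatial_injective hu huu
  range_Φ₃ := range_spatial hu huu
  u := u
  adjoint_u_comp_u := rfl
  u_comp_adjoint_u := huu
  Φ₃_apply _ := rfl
  Φ₃_intertwines := spatial_reducedAntiAut hα hu huu
  factorization a := (spatial_reduce_amplify hu huu a).symm

theorem Factorization.bijective_of_surjective {α₁ : InvolutiveStarAntiAut M₁.toStarSubalgebra}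
    {α₂ : InvolutiveStarAntiAut M₂.toStarSubalgebra} (F : Factorization α₁ α₂ Φ L)
    (h : Function.Surjective Φ) : Function.Bijective F.Φ₃ := by
  refine ⟨F.Φ₃_injective, ?_⟩
  rw [← Set.range_eq_univ, F.range_Φ₃, Set.range_eq_univ]
  exact h

end Build


/-! ### Transposes with respect to a conjugation. -/

section Transpose

variable {H : Type*} [NormedAddCommGroup H] [InnerProductSpace ℂ H]

theorem Conjugation.sandwich_add (c : Conjugation H) (x y : H →L[ℂ] H) :
    c.sandwich (x + y) = c.sandwich x + c.sandwich y := by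
  ext ξ
  exact map_add c.toLinearIsometry _ _

theorem Conjugation.sandwich_smul (c : Conjugation H) (r : ℂ) (x : H →L[ℂ] H) :
    c.sandwich (r • x) = (starRingEnd ℂ r) • c.sandwich x := by
  ext ξ
  exact c.map_smul_conj r _

theorem Conjugation.sandwich_mul (c : Conjugation H) (x y : H →L[ℂ] H) :
    c.sandwich (x * y) = c.sandwich x * c.sandwich y := by
  ext ξ
  change c (x (y (c ξ))) = c (x (c (c (y (c ξ)))))
  rw [c.apply_apply]

theorem Conjugation.sandwich_sandwich (c : Conjugation H) (x : H →L[ℂ] H) :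
    c.sandwich (c.sandwich x) = x := by
  ext ξ
  change c (c (x (c (c ξ)))) = x ξ
  rw [c.apply_apply, c.apply_apply]

variable [CompleteSpace H]

theorem Conjugation.star_sandwich (c : Conjugation H) (x : H →L[ℂ] H) :
    star (c.sandwich x) = c.sandwich (star x) := by
  ext ξ
  refine ext_inner_right ℂ fun ζ => ?_
  rw [ContinuousLinearMap.star_eq_adjoint, ContinuousLinearMap.adjoint_inner_left,
    c.sandwich_apply, c.sandwich_apply, c.inner_apply_right, c.inner_apply_left,
    ContinuousLinearMap.star_eq_adjoint, ContinuousLinearMap.adjoint_inner_right]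

theorem Conjugation.transpose_transpose (c : Conjugation H) (x : H →L[ℂ] H) :
    c.transpose (c.transpose x) = x := by
  rw [Conjugation.transpose, Conjugation.transpose, c.star_sandwich, c.sandwich_sandwich, star_star]

/-- The transpose as an antiautomorphism of an invariant von Neumann algebra. -/
noncomputable def Conjugation.transposeAntiAut (c : Conjugation H) (N : VonNeumannAlgebra H)
    (h : ∀ x ∈ N, c.transpose x ∈ N) : InvolutiveStarAntiAut N.toStarSubalgebra where
  toFun x := ⟨c.transpose x, h x x.2⟩
  map_add' x y := Subtype.ext <| by
    change c.sandwich (star ((x : H →L[ℂ] H) + y)) = c.sandwich (star (x : H →L[ℂ] H)) +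
      c.sandwich (star (y : H →L[ℂ] H))
    rw [star_add, c.sandwich_add]
  map_smul' r x := Subtype.ext <| by
    change c.sandwich (star (r • (x : H →L[ℂ] H))) = r • c.sandwich (star (x : H →L[ℂ] H))
    rw [star_smul, c.sandwich_smul, Complex.star_def, Complex.conj_conj]
  map_star' x := Subtype.ext (c.star_sandwich (star (x : H →L[ℂ] H))).symm
  map_mul_rev' x y := Subtype.ext <| by
    change c.sandwich (star ((x : H →L[ℂ] H) * y)) = c.sandwich (star (y : H →L[ℂ] H)) *
      c.sandwich (star (x : H →L[ℂ] H))
    rw [star_mul, c.sandwich_mul]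
  involutive' x := Subtype.ext (c.transpose_transpose (x : H →L[ℂ] H))

theorem Conjugation.transpose_adjoint_comp_self {K : Type*} [NormedAddCommGroup K]
    [InnerProductSpace ℂ K] [CompleteSpace K] {c : Conjugation H} {d : Conjugation K}
    {u : H →L[ℂ] K} (h : ∀ ξ, u (c ξ) = d (u ξ)) :
    c.transpose (u.adjoint.comp u) = u.adjoint.comp u := by
  have hsa : star (u.adjoint.comp u) = u.adjoint.comp u :=
    (ContinuousLinearMap.isPositive_adjoint_comp_self u).isSelfAdjoint
  rw [Conjugation.transpose, hsa]
  ext ξ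
  change c (u.adjoint (u (c ξ))) = u.adjoint (u ξ)
  rw [h, Conjugation.adjoint_commutes h, c.apply_apply]

theorem ActsOnRealForm.transpose_eq {M : VonNeumannAlgebra H}
    {α : InvolutiveStarAntiAut M.toStarSubalgebra} {c : Conjugation H}
    (h : ActsOnRealForm M α c) (a : M.toStarSubalgebra) :
    c.transpose (a : H →L[ℂ] H) = (α a : H →L[ℂ] H) := by
  ext ξ
  have h1 := h.apply_conj (star a) (c ξ)
  have h2 : α (star a) = star (α a) := α.map_star' a
  rw [h2, c.apply_apply] at h1
  have h3 : star ((star (α a) : M.toStarSubalgebra) : H →L[ℂ] H) = (α a : H →L[ℂ] H) :=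
    star_star _
  rw [h3] at h1
  exact h1

/-- The transposes with respect to two commuting conjugations. -/
theorem ActsOnRealForm.transpose_eq_sandwich {M : VonNeumannAlgebra H}
    {α : InvolutiveStarAntiAut M.toStarSubalgebra} {c J : Conjugation H}
    (h : ActsOnRealForm M α c) (hJ : ∀ ξ, J (c ξ) = c (J ξ)) {x : H →L[ℂ] H}
    {a : M.toStarSubalgebra} (ha : (a : H →L[ℂ] H) = J.sandwich x) :
    c.transpose x = J.sandwich (α a : H →L[ℂ] H) := by
  -- With `α(a) = c a⋆ c` and `a = J x J`, the right side is `J c J x⋆ J c J`, which collapses to `c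
  -- x⋆ c` since `J` and `c` commute.
  rw [← h.transpose_eq, ha, Conjugation.transpose, Conjugation.transpose, J.star_sandwich]
  ext ξ
  change c (star x (c ξ)) = J (c (J (star x (J (c (J ξ))))))
  rw [hJ (J ξ), J.apply_apply, ← hJ, J.apply_apply]

end Transpose

/-! ### The transpose on `H ⊗ L` and on the commutant of the amplification. -/

section TensorTranspose

variable {H : Type u} {L : Type v} [NormedAddCommGroup H] [InnerProductSpace ℂ H]
  [NormedAddCommGroup L] [InnerProductSpace ℂ L] [CompleteSpace H] [CompleteSpace L]

theorem transpose_tensorOp (c : Conjugation H) (d : Conjugation L) (x : H →L[ℂ] H)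
    (y : L →L[ℂ] L) :
    (c.tensor d).transpose (tensorOp x y) = tensorOp (c.transpose x) (d.transpose y) := by
  refine hilbertTensor_ext fun ξ ζ => ?_
  rw [Conjugation.transpose, star_tensorOp, Conjugation.sandwich_apply,
    Conjugation.tensor_tmulHat, tensorOp_tmulHat, Conjugation.tensor_tmulHat, tensorOp_tmulHat]
  rfl

theorem transpose_one (d : Conjugation L) : d.transpose (1 : L →L[ℂ] L) = 1 := by
  rw [Conjugation.transpose, star_one]
  ext ζ
  exact d.apply_apply ζ

/-- The transpose reverses products and carries `α(a) ⊗ 1` to `a ⊗ 1`, so it turns commutation with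
the first into commutation with the second. -/
theorem ActsOnRealForm.transpose_mem_commutant {M : VonNeumannAlgebra H}
    {α : InvolutiveStarAntiAut M.toStarSubalgebra} {c : Conjugation H}
    (h : ActsOnRealForm M α c) (d : Conjugation L)
    (t : HilbertTensor H L →L[ℂ] HilbertTensor H L) (ht : t ∈ (amplification L M).commutant) :
    (c.tensor d).transpose t ∈ (amplification L M).commutant := by
  rw [mem_commutant_amplification_iff] at ht ⊢
  intro a
  have hαα : α (α a) = a := α.involutive' a
  have h1 : tensorOp (a : H →L[ℂ] H) (1 : L →L[ℂ] L) =
      (c.tensor d).transpose (tensorOp (α a : H →L[ℂ] H) 1) := by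
    rw [transpose_tensorOp, h.transpose_eq, hαα, transpose_one]
  rw [h1, Conjugation.transpose, Conjugation.transpose, ← Conjugation.sandwich_mul,
    ← Conjugation.sandwich_mul, ← star_mul, ← star_mul, ht (α a)]

end TensorTranspose

/-! ### Intertwiners compatible with the real forms. -/

section RealIntertwiner

variable {H₁ : Type*} [NormedAddCommGroup H₁] [InnerProductSpace ℂ H₁] [CompleteSpace H₁]
  {H₂ : Type*} [NormedAddCommGroup H₂] [InnerProductSpace ℂ H₂] [CompleteSpace H₂]
  {M₁ : VonNeumannAlgebra H₁} {M₂ : VonNeumannAlgebra H₂}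
  {α₁ : InvolutiveStarAntiAut M₁.toStarSubalgebra}
  {α₂ : InvolutiveStarAntiAut M₂.toStarSubalgebra}
  {Φ : M₁.toStarSubalgebra →⋆ₙₐ[ℂ] M₂.toStarSubalgebra}
  {c₁ : Conjugation H₁} {c₂ : Conjugation H₂}

/-- Passing `c₁` turns `a` into `α₁(a)⋆`, and passing `c₂` turns `Φ(α₁(a)⋆)` back into `Φ(a)`. -/
theorem IsIntertwiner.conjOp (hα : ∀ a, Φ (α₁ a) = α₂ (Φ a)) (h₁ : ActsOnRealForm M₁ α₁ c₁)
    (h₂ : ActsOnRealForm M₂ α₂ c₂) {W : H₁ →L[ℂ] H₂} (hW : IsIntertwiner Φ W) :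
    IsIntertwiner Φ (c₁.conjOp c₂ W) := by
  intro a ξ
  have hs : star (α₂ (Φ (star (α₁ a)))) = Φ a := by
    rw [← hα, show α₁ (star (α₁ a)) = star (α₁ (α₁ a)) from α₁.map_star' _,
      show α₁ (α₁ a) = a from α₁.involutive' a, map_star, star_star]
  rw [Conjugation.conjOp_apply, Conjugation.conjOp_apply, h₁.apply_conj]
  have h3 : W ((star (α₁ a) : H₁ →L[ℂ] H₁) (c₁ ξ)) =
      (Φ (star (α₁ a)) : H₂ →L[ℂ] H₂) (W (c₁ ξ)) := hW (star (α₁ a)) (c₁ ξ)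
  rw [h3, h₂.apply_conj]
  have h4 : star (α₂ (Φ (star (α₁ a))) : H₂ →L[ℂ] H₂) = (Φ a : H₂ →L[ℂ] H₂) :=
    congrArg Subtype.val hs
  rw [h4]

theorem IsIntertwiner.exists_real (hα : ∀ a, Φ (α₁ a) = α₂ (Φ a)) (h₁ : ActsOnRealForm M₁ α₁ c₁)
    (h₂ : ActsOnRealForm M₂ α₂ c₂) {W : H₁ →L[ℂ] H₂} (hW : IsIntertwiner Φ W) (hne : W ≠ 0) :
    ∃ W' : H₁ →L[ℂ] H₂, IsIntertwiner Φ W' ∧ W' ≠ 0 ∧ (∀ ξ, W' (c₁ ξ) = c₂ (W' ξ)) ∧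
      ∀ Z : H₁ →L[ℂ] H₂, (∀ ξ, Z (c₁ ξ) = c₂ (Z ξ)) → (∀ ξ, Z.adjoint (W ξ) = 0) →
        ∀ ξ, Z.adjoint (W' ξ) = 0 := by
  set X := c₁.conjOp c₂ W with hX
  have hXi : IsIntertwiner Φ X := hW.conjOp hα h₁ h₂
  have hZX : ∀ Z : H₁ →L[ℂ] H₂, (∀ ξ, Z (c₁ ξ) = c₂ (Z ξ)) → (∀ ξ, Z.adjoint (W ξ) = 0) →
      ∀ ξ, Z.adjoint (X ξ) = 0 := by
    intro Z hZ hZW ξ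
    rw [hX, Conjugation.conjOp_apply, Conjugation.adjoint_commutes hZ, hZW]
    exact map_zero c₁.toLinearIsometry
  have hXc : ∀ ξ, X (c₁ ξ) = c₂ (W ξ) := fun ξ => by
    rw [hX, Conjugation.conjOp_apply, c₁.apply_apply]
  have hWc : ∀ ξ, W (c₁ ξ) = c₂ (X ξ) := fun ξ => by
    rw [hX, Conjugation.conjOp_apply, c₂.apply_apply]
  -- `W + X` and `i(W - X)` are both real. If the first vanishes, the second is `2iW ≠ 0`.
  by_cases h0 : W + X = 0
  · refine ⟨Complex.I • (W - X), ?_, ?_, ?_, ?_⟩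
    · intro a ξ
      change Complex.I • (W _ - X _) = (Φ a : H₂ →L[ℂ] H₂) (Complex.I • (W ξ - X ξ))
      rw [hW, hXi, map_smul, map_sub]
    · intro h
      have h1 : W - X = 0 := (smul_eq_zero.1 h).resolve_left Complex.I_ne_zero
      have h2 : (2 : ℂ) • W = 0 := by
        rw [two_smul]
        nth_rw 2 [sub_eq_zero.1 h1]
        exact h0
      exact hne ((smul_eq_zero.1 h2).resolve_left two_ne_zero)
    · intro ξ
      change Complex.I • (W (c₁ ξ) - X (c₁ ξ)) = c₂ (Complex.I • (W ξ - X ξ))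
      rw [hWc, hXc, c₂.map_smul_conj, map_sub, Complex.conj_I, neg_smul, ← smul_neg, neg_sub]
    · intro Z hZ hZW ξ
      change Z.adjoint (Complex.I • (W ξ - X ξ)) = 0
      rw [map_smul, map_sub, hZW, hZX Z hZ hZW, sub_zero, smul_zero]
  · refine ⟨W + X, ?_, h0, ?_, ?_⟩
    · intro a ξ
      change W _ + X _ = (Φ a : H₂ →L[ℂ] H₂) (W ξ + X ξ)
      rw [hW, hXi, map_add]
    · intro ξ
      change W (c₁ ξ) + X (c₁ ξ) = c₂ (W ξ + X ξ)
      rw [hWc, hXc, map_add, add_comm]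
    · intro Z hZ hZW ξ
      change Z.adjoint (W ξ + X ξ) = 0
      rw [map_add, hZW, hZX Z hZ hZW, add_zero]

end RealIntertwiner

theorem nontrivial_lp (ι : Type*) [Nonempty ι] : Nontrivial (lp (fun _ : ι => ℂ) 2) := by
  classical
  obtain ⟨i⟩ := ‹Nonempty ι›
  exact ⟨⟨_, 0, (orthonormal_lp_single ι).ne_zero i⟩⟩

end RealW

theorem mainTheorem7
    {H₁ : Type u} [NormedAddCommGroup H₁] [InnerProductSpace ℂ H₁] [CompleteSpace H₁]
    {H₂ : Type v} [NormedAddCommGroup H₂] [InnerProductSpace ℂ H₂] [CompleteSpace H₂]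
    (M₁ : VonNeumannAlgebra H₁) (M₂ : VonNeumannAlgebra H₂)
    (α₁ : RealW.InvolutiveStarAntiAut M₁.toStarSubalgebra)
    (α₂ : RealW.InvolutiveStarAntiAut M₂.toStarSubalgebra)
    (Φ : M₁.toStarSubalgebra →⋆ₙₐ[ℂ] M₂.toStarSubalgebra) (hΦ : RealW.IsNormal Φ)
    (hα : ∀ a, Φ (α₁ a) = α₂ (Φ a)) :
    -- for arbitrary involutive antiautomorphisms there is an intertwining factorization
    (∃ (L : Type v) (_ : NormedAddCommGroup L) (_ : InnerProductSpace ℂ L) (_ : CompleteSpace L)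
      (F : RealW.Factorization α₁ α₂ Φ L), Function.Surjective Φ → Function.Bijective F.Φ₃) ∧
    -- if the real algebras act on real forms of `H₁`, `H₂`, the projection can be taken invariant
    (∀ (c₁ : RealW.Conjugation H₁) (c₂ : RealW.Conjugation H₂),
      RealW.ActsOnRealForm M₁ α₁ c₁ → RealW.ActsOnRealForm M₂ α₂ c₂ →
      ∃ (L : Type v) (_ : NormedAddCommGroup L) (_ : InnerProductSpace ℂ L) (_ : CompleteSpace L)
        (F : RealW.Factorization α₁ α₂ Φ L) (cL : RealW.Conjugation L)
        (αt' : RealW.InvolutiveStarAntiAut (RealW.amplification L M₁).commutant.toStarSubalgebra),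
        (Function.Surjective Φ → Function.Bijective F.Φ₃) ∧
        -- the antiautomorphism `αt'` of the commutant
        (∀ t, (αt' t : RealW.HilbertTensor H₁ L →L[ℂ] RealW.HilbertTensor H₁ L) =
          (c₁.tensor cL).transpose t) ∧
        (∀ J : RealW.Conjugation H₁,
          (∀ x : H₁ →L[ℂ] H₁, x ∈ M₁.commutant ↔ J.sandwich x ∈ M₁) →
          (∀ ξ, J (c₁ ξ) = c₁ (J ξ)) →
          ∀ (x' : H₁ →L[ℂ] H₁) (a : M₁.toStarSubalgebra) (y : L →L[ℂ] L)
            (t : (RealW.amplification L M₁).commutant.toStarSubalgebra),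
            (a : H₁ →L[ℂ] H₁) = J.sandwich x' →
            (t : RealW.HilbertTensor H₁ L →L[ℂ] RealW.HilbertTensor H₁ L) =
              RealW.tensorOp x' y →
            (αt' t : RealW.HilbertTensor H₁ L →L[ℂ] RealW.HilbertTensor H₁ L) =
              RealW.tensorOp (J.sandwich (α₁ a : H₁ →L[ℂ] H₁)) (cL.transpose y)) ∧
        -- the projection is invariant, and the implementing operator respects the real forms
        αt' ⟨F.p, F.p_mem⟩ = ⟨F.p, F.p_mem⟩ ∧
        (∀ ξ, F.u (c₁.tensor cL ξ) = c₂ (F.u ξ))) := by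
  classical
  -- The index set `H₂` contains `0`, so `L ≠ 0` even when `H₂ = 0`; this keeps `a ↦ a ⊗ 1`
  -- injective.
  have := RealW.nontrivial_lp H₂
  refine ⟨?_, fun c₁ c₂ h₁ h₂ => ?_⟩
  · obtain ⟨V, hV, -, hp, horth, htotal⟩ := hΦ.exists_family (fun _ => True) trivial
      fun W hW hne => by
        obtain ⟨V, h1, h2, h3, h4, -⟩ := hW.exists_partialIsometry hne
        exact ⟨V, h1, h2, h3, trivial, fun Z _ => h4 Z⟩
    obtain ⟨u, -, hu, huu⟩ := RealW.exists_implementing_operator V hV hp horth htotal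
    let F := RealW.Factorization.ofOperator α₁ α₂ hα hu huu
    exact ⟨lp (fun _ : H₂ => ℂ) 2, inferInstance, inferInstance, inferInstance, F,
      F.bijective_of_surjective⟩
  · obtain ⟨V, hV, hVc, hp, horth, htotal⟩ := hΦ.exists_family
      (fun V => ∀ ξ, V (c₁ ξ) = c₂ (V ξ)) (fun _ => (map_zero c₂.toLinearIsometry).symm)
      fun W hW hne => by
        obtain ⟨W', hW', hne', hc', hZ'⟩ := hW.exists_real hα h₁ h₂ hne
        obtain ⟨V, h1, h2, h3, h4, h5⟩ := hW'.exists_partialIsometry hne'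
        exact ⟨V, h1, h2, h3, h5 c₁ c₂ hc', fun Z hZ hZW => h4 Z (hZ' Z hZ hZW)⟩
    obtain ⟨u, huV, hu, huu⟩ := RealW.exists_implementing_operator V hV hp horth htotal
    let F := RealW.Factorization.ofOperator α₁ α₂ hα hu huu
    let cL := RealW.lpConjugation H₂
    -- The basis vectors of `ℓ²` are fixed by `cL`, so reality of `u` can be checked on its
    -- components `V i`.
    have huc : ∀ ξ, u (c₁.tensor cL ξ) = c₂ (u ξ) := by
      rw [RealW.Conjugation.commutes_iff]
      refine RealW.hilbertTensor_lp_ext fun ξ i => ?_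
      rw [RealW.Conjugation.conjOp_apply, RealW.Conjugation.tensor_tmulHat,
        RealW.lpConjugation_single, huV, huV, hVc, c₂.apply_apply]
    refine ⟨lp (fun _ : H₂ => ℂ) 2, inferInstance, inferInstance, inferInstance, F, cL,
      (c₁.tensor cL).transposeAntiAut _ (h₁.transpose_mem_commutant cL),
      F.bijective_of_surjective, fun _ => rfl, ?_, ?_, huc⟩
    · intro J _ hJ x' a y t ha ht
      change (c₁.tensor cL).transpose (t : RealW.HilbertTensor H₁ _ →L[ℂ] _) = _
      rw [ht, RealW.transpose_tensorOp, h₁.transpose_eq_sandwich hJ ha]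
    · exact Subtype.ext (RealW.Conjugation.transpose_adjoint_comp_self huc)
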